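/- Let $k$ be a field of characteristic $p>0$, let $n,d\ge 0$ be integers, and suppose $p\ge\max(n,2d)$. Let $U_n$ be the algebraic group over $k$ of unipotent upper triangular $n\times n$ matrices, with coordinate ring $A_n=k[x_{ij}:1\le i<j\le n]$, comultiplication $\Delta(x_{ij})=1\otimes x_{ij}+\sum_{i<l<j}x_{il}\otimes x_{lj}+x_{ij}\otimes 1$ and counit $\varepsilon(x_{ij})=0$. A representation of $U_n$ on a $k$-vector space $V$ is a $k$-linear map $\rho:V\to V\otimes A_n$ that makes $V$ a right $A_n$-comodule; its matrix formula in a basis $e_1,\dots,e_d$ of $V$ is the matrix $(a_{ij})$ over $A_n$ with $\rho(e_j)=\sum_i e_i\otimes a_{ij}$. Let $\mathfrak u_n$ be the Lie algebra of strictly upper triangular $n\times n$ matrices over $k$, with basis the matrix units $\varepsilon_{ij}$, $i<j$, and let $\mathfrak{gl}_d$ be the Lie algebra of $d\times d$ matrices over $k$. Let $g=1+\sum_{i<j}x_{ij}\varepsilon_{ij}$ be the general element of $U_n$, and let $\log g=\sum_{r=1}^{n-1}\frac{(-1)^{r-1}}{r}(g-1)^r$. For a linear map $\phi:\mathfrak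 u_n\to\mathfrak{gl}_d$, $\phi(\log g)$ denotes the value at $\log g$ of the $A_n$-linear extension of $\phi$, that is $\sum_{i<j}(\log g)_{ij}\,\phi(\varepsilon_{ij})$. For a nilpotent $d\times d$ matrix $N$ over $A_n$ let $e^N=\sum_{r=0}^{d-1}N^r/r!$. For a matrix $M$ over $A_n$ and $s\ge 1$, let $M^{[s]}$ be the matrix obtained from $M$ by replacing each variable $x_{ij}$ by $x_{ij}^s$, the scalars being left unchanged. (1) Let $m\ge 0$ and let $\phi_0,\dots,\phi_m:\mathfrak u_n\to\mathfrak{gl}_d$ be Lie algebra homomorphisms such that (a) $\phi_i(X)$ is a nilpotent matrix for all $X\in\mathfrak u_n$ and $0\le i\le m$, and (b) $\phi_i(X)$ commutes with $\phi_j(Y)$ for all $i\ne j$ and $X,Y\in\mathfrak u_n$. Then $$\Phi(g)=e^{\phi_0(\log g)}\,\bigl(e^{\phi_1(\log g)}\bigr)^{[p]}\cdots\bigl(e^{\phi_m(\log g)}\bigr)^{[p^m]}$$ is the matrix formula of a $d$-dimensional representation of $U_n$ over $k$, in any basis of a $d$-dimensional vector space. (2) For every representation of $U_n$ over $k$ on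 a $d$-dimensional vector space and every basis of that space, the matrix formula of the representation in this basis is $\Phi(g)$ for some $m\ge 0$ and some $\phi_0,\dots,\phi_m$ as in (1). -/

import Mathlib

open scoped TensorProduct

attribute [local instance] LieRing.ofAssociativeRing

namespace UnipotentRep

universe u v

/-- The Lie algebra `𝔲ₙ` of strictly upper triangular `n × n` matrices over `k`, with the
commutator bracket. -/
def strictUpper (k : Type u) [Field k] (n : ℕ) : LieSubalgebra k (Matrix (Fin n) (Fin n) k) where
  carrier := {M | ∀ i j, j ≤ i → M i j = 0}
  add_mem' := by
    intro a b ha hb i j hij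
    simp [ha i j hij, hb i j hij]
  zero_mem' := by
    intro i j _
    rfl
  smul_mem' := by
    intro c a ha i j hij
    simp [ha i j hij]
  lie_mem' := by
    have key : ∀ a b : Matrix (Fin n) (Fin n) k, (∀ i j, j ≤ i → a i j = 0) →
        (∀ i j, j ≤ i → b i j = 0) → ∀ i j, j ≤ i → (a * b) i j = 0 := by
      intro a b ha hb i j hij
      rw [Matrix.mul_apply]
      refine Finset.sum_eq_zero fun l _ => ?_
      rcases le_total l i with h | h
      · rw [ha i l h, zero_mul]
      · rw [hb l j (hij.trans h), mul_zero]
    intro a b ha hb i j hij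
    rw [LieRing.of_associative_ring_bracket, Matrix.sub_apply, key a b ha hb i j hij,
      key b a hb ha i j hij, sub_zero]

/-- The positions strictly above the diagonal of an `n × n` matrix. -/
abbrev Pos (n : ℕ) : Type := {q : Fin n × Fin n // q.1 < q.2}

/-- The matrix unit `ε_{ij}`, `i < j`, as an element of `𝔲ₙ`. -/
def unit (k : Type u) [Field k] {n : ℕ} (q : Pos n) : strictUpper k n :=
  ⟨Matrix.single q.1.1 q.1.2 1, by
    intro i j hij
    refine Matrix.single_apply_of_ne _ _ _ _ _ ?_
    rintro ⟨rfl, rfl⟩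
    exact absurd q.2 (not_lt.mpr hij)⟩

/-- The coordinate ring `Aₙ = k[x_{ij} : i < j]` of the algebraic group `Uₙ` of unipotent upper
triangular `n × n` matrices. -/
abbrev Coord (k : Type u) [Field k] (n : ℕ) : Type u := MvPolynomial (Pos n) k

/-- The coordinate function `x_{ij}`, read as `0` unless `i < j`. -/
noncomputable def coordFn (k : Type u) [Field k] {n : ℕ} (i j : Fin n) : Coord k n :=
  if h : i < j then MvPolynomial.X ⟨(i, j), h⟩ else 0

/-- The comultiplication of `Aₙ`:
`x_{ij} ↦ 1 ⊗ x_{ij} + ∑_{i < l < j} x_{il} ⊗ x_{lj} + x_{ij} ⊗ 1`. -/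
noncomputable def comul (k : Type u) [Field k] (n : ℕ) :
    Coord k n →ₐ[k] Coord k n ⊗[k] Coord k n :=
  MvPolynomial.aeval fun q : Pos n =>
    1 ⊗ₜ[k] coordFn k q.1.1 q.1.2
      + ∑ l ∈ Finset.Ioo q.1.1 q.1.2, coordFn k q.1.1 l ⊗ₜ[k] coordFn k l q.1.2
      + coordFn k q.1.1 q.1.2 ⊗ₜ[k] 1

/-- The counit of `Aₙ`: `x_{ij} ↦ 0`. -/
noncomputable def counit (k : Type u) [Field k] (n : ℕ) : Coord k n →ₐ[k] k :=
  MvPolynomial.aeval fun _ : Pos n => (0 : k)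

/-- A representation of the algebraic group `Uₙ` on `V`: a linear map `ρ : V → V ⊗ Aₙ` that makes
`V` a right `Aₙ`-comodule. -/
structure IsRepresentation {k : Type u} [Field k] {n : ℕ} {V : Type v} [AddCommGroup V]
    [Module k V] (ρ : V →ₗ[k] V ⊗[k] Coord k n) : Prop where
  coassoc : ∀ w : V,
    TensorProduct.assoc k V (Coord k n) (Coord k n) (ρ.rTensor (Coord k n) (ρ w))
      = (comul k n).toLinearMap.lTensor V (ρ w)
  counit : ∀ w : V, (counit k n).toLinearMap.lTensor V (ρ w) = w ⊗ₜ[k] (1 : k)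

/-- The linear map `V → V ⊗ Aₙ`, `e_j ↦ ∑ i, e_i ⊗ a_{ij}`, with matrix formula `(a_{ij})` in the
basis `e` of `V`. -/
noncomputable def ofMatrix {k : Type u} [Field k] {n d : ℕ} {V : Type v} [AddCommGroup V]
    [Module k V] (e : Module.Basis (Fin d) k V) (a : Matrix (Fin d) (Fin d) (Coord k n)) :
    V →ₗ[k] V ⊗[k] Coord k n :=
  e.constr k fun j => ∑ i, e i ⊗ₜ[k] a i j

/-- The general element `g = 1 + ∑_{i < j} x_{ij} ε_{ij}` of `Uₙ`. -/
noncomputable def generic (k : Type u) [Field k] (n : ℕ) : Matrix (Fin n) (Fin n) (Coord k n) :=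
  1 + Matrix.of fun i j => coordFn k i j

/-- `log g = ∑_{r = 1}^{n - 1} (-1)^{r - 1} / r • (g - 1) ^ r` for the general element `g` of `Uₙ`;
as `(g - 1) ^ n = 0` this is the full logarithm series. -/
noncomputable def logGeneric (k : Type u) [Field k] (n : ℕ) :
    Matrix (Fin n) (Fin n) (Coord k n) :=
  ∑ r ∈ Finset.Ico 1 n, ((-1 : k) ^ (r - 1) / (r : k)) • (generic k n - 1) ^ r

/-- The value at a strictly upper triangular matrix `Y` over `Aₙ` of the `Aₙ`-linear extension of
the `k`-linear map `φ`, that is `∑_{i < j} Y_{ij} φ(ε_{ij})`. -/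
noncomputable def extend {k : Type u} [Field k] {n d : ℕ}
    (φ : strictUpper k n →ₗ⁅k⁆ Matrix (Fin d) (Fin d) k)
    (Y : Matrix (Fin n) (Fin n) (Coord k n)) : Matrix (Fin d) (Fin d) (Coord k n) :=
  ∑ q : Pos n, Y q.1.1 q.1.2 • (φ (unit k q)).map MvPolynomial.C

/-- The exponential `∑_{r < d} N ^ r / r!` of a nilpotent `d × d` matrix `N` over the domain `Aₙ`;
as `N ^ d = 0` this is the full exponential series. -/
noncomputable def nilExp {k : Type u} [Field k] {n d : ℕ}
    (N : Matrix (Fin d) (Fin d) (Coord k n)) : Matrix (Fin d) (Fin d) (Coord k n) :=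
  ∑ r ∈ Finset.range d, ((r.factorial : k)⁻¹) • N ^ r

/-- `M ↦ M^{[s]}`: replace each variable `x_{ij}` by `x_{ij} ^ s` and keep the scalars. -/
noncomputable def powVars {k : Type u} [Field k] {n d : ℕ} (s : ℕ)
    (M : Matrix (Fin d) (Fin d) (Coord k n)) : Matrix (Fin d) (Fin d) (Coord k n) :=
  M.map (MvPolynomial.expand s)

/-- The matrix formula
`Φ(g) = e^{φ₀(log g)} (e^{φ₁(log g)})^{[p]} ⋯ (e^{φₘ(log g)})^{[p ^ m]}`, with the factors multiplied
in this order. -/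
noncomputable def bigPhi {k : Type u} [Field k] {n d : ℕ} (p m : ℕ)
    (φ : Fin (m + 1) → (strictUpper k n →ₗ⁅k⁆ Matrix (Fin d) (Fin d) k)) :
    Matrix (Fin d) (Fin d) (Coord k n) :=
  (List.ofFn fun l : Fin (m + 1) =>
    powVars (p ^ (l : ℕ)) (nilExp (extend (φ l) (logGeneric k n)))).prod

/-- The conditions on `φ₀, …, φₘ : 𝔲ₙ → 𝔤𝔩_d`: all values are nilpotent matrices, and the values of
`φᵢ` commute with those of `φⱼ` for `i ≠ j`. -/
structure IsCommutingNilpotent {k : Type u} [Field k] {n d m : ℕ}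
    (φ : Fin (m + 1) → (strictUpper k n →ₗ⁅k⁆ Matrix (Fin d) (Fin d) k)) : Prop where
  nilpotent : ∀ i X, IsNilpotent (φ i X)
  commute : ∀ i j, i ≠ j → ∀ X Y, Commute (φ i X) (φ j Y)

end UnipotentRep

/-! A comodule structure with matrix formula `a` is the same as a family of homomorphisms `U_n(B) →
GL_d(B)`, natural in the commutative `k`-algebra `B` (`isRepresentation_ofMatrix_iff`). Both halves
thus concern groups of points, and these are generated by elementary matrices (`IsUnip.induction`).

For (1) the point is that `U ↦ exp (φ (log U))` is multiplicative (`groupExp_mul`). A differential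
equation replaces the Baker–Campbell–Hausdorff formula. For an elementary matrix `1 + Y` put `V(t) =
U (1 + tY)` and `Z = log V`. The logarithmic derivative of `exp Z` is a universal series of iterated
commutators in `Z` and `Z'`, and it equals `V⁻¹ V' = Y`. A Lie homomorphism respects such a series,
so `W = exp φ(Z)` satisfies `W' = W φ(Y)`. Since `Z` is of degree at most 1 in `t`, `W` is of degree
less than `d ≤ p`, and the equation forces `W(1) = W(0) exp φ(Y)` (`groupExp_mul_one_add`).
Frobenius twists are precompositions with endomorphisms of `U_n`, and pointwise commuting
homomorphisms multiply to a homomorphism.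

For (2), restrict to `t ↦ 1 + t ε_ij` and expand as `∑ t^r c_r`, so that `c_a c_b = binom(a+b, a)
c_{a+b}`. Such a family is determined by the nilpotent matrices `c_{p^l}` (`IsOneParam.ext_of_pow`),
and `c_r = 0` once the lowest nonzero base-`p` digit of `r` is at least `d`. If `x + y = p^l` with
`x, y > 0`, these digits of `x` and `y` add up to `p ≥ 2d`, so one of them is at least `d`
(`IsOneParam.eq_zero_or_eq_zero`). Hence in the commutator relation of two elementary subgroups the
mixed terms at `s^(p^l) t^(p^m)` vanish. What remains are the relations of `𝔲_n` for `l = m`, and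
commutation for `l ≠ m`. The resulting `φ_l` give a `Φ` with the same `c_{p^l}`, hence the same
values on elementary matrices, hence everywhere. -/

namespace UnipotentRep

universe u v

/-! ### Matrices supported on high superdiagonals -/

/-- `M` is supported on the superdiagonals `j - i ≥ h`. -/
def HeightGE {B : Type*} [Zero B] {n : ℕ} (h : ℕ) (M : Matrix (Fin n) (Fin n) B) : Prop :=
  ∀ i j : Fin n, (j : ℕ) < i + h → M i j = 0

namespace HeightGE

variable {B : Type*} [Ring B] {n h h' : ℕ} {M N : Matrix (Fin n) (Fin n) B}

theorem mono (hM : HeightGE h M) (hh : h' ≤ h) : HeightGE h' M :=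
  fun i j hij => hM i j (by omega)

theorem zero (h : ℕ) : HeightGE h (0 : Matrix (Fin n) (Fin n) B) := fun _ _ _ => rfl

theorem add (hM : HeightGE h M) (hN : HeightGE h N) : HeightGE h (M + N) := fun i j hij => by
  simp [hM i j hij, hN i j hij]

theorem sub (hM : HeightGE h M) (hN : HeightGE h N) : HeightGE h (M - N) := fun i j hij => by
  simp [hM i j hij, hN i j hij]

theorem smul {S : Type*} [SMulZeroClass S B] (c : S) (hM : HeightGE h M) :
    HeightGE h (c • M) := fun i j hij => by
  simp [hM i j hij]

theorem sum {ι : Type*} {s : Finset ι} {f : ι → Matrix (Fin n) (Fin n) B}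
    (hf : ∀ x ∈ s, HeightGE h (f x)) : HeightGE h (∑ x ∈ s, f x) := fun i j hij => by
  rw [Matrix.sum_apply]
  exact Finset.sum_eq_zero fun x hx => hf x hx i j hij

theorem mul (hM : HeightGE h M) (hN : HeightGE h' N) : HeightGE (h + h') (M * N) :=
  fun i j hij => by
    rw [Matrix.mul_apply]
    refine Finset.sum_eq_zero fun l _ => ?_
    by_cases hl : (l : ℕ) < i + h
    · rw [hM i l hl, zero_mul]
    · rw [hN l j (by omega), mul_zero]

theorem one : HeightGE 0 (1 : Matrix (Fin n) (Fin n) B) := fun i j hij =>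
  Matrix.one_apply_ne (by rintro rfl; omega)

theorem pow (hM : HeightGE 1 M) (r : ℕ) : HeightGE r (M ^ r) := by
  induction r with
  | zero => simpa using one
  | succ r ih => rw [pow_succ]; exact ih.mul hM

theorem eq_zero (hM : HeightGE h M) (hn : n ≤ h) : M = 0 := by
  ext i j
  exact hM i j (by omega)

theorem map {C : Type*} [Zero C] (hM : HeightGE h M) (f : B → C) (hf : f 0 = 0) :
    HeightGE h (M.map f) := fun i j hij => by
  rw [Matrix.map_apply, hM i j hij, hf]

end HeightGE

/-! ### The truncated exponential and logarithm -/

section Exp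

variable (k : Type u) [Field k]

/-- `∑_{r < s} N ^ r / r!`. -/
noncomputable def truncExp {R : Type*} [Ring R] [Algebra k R] (s : ℕ) (N : R) : R :=
  ∑ r ∈ Finset.range s, ((r.factorial : k)⁻¹) • N ^ r

/-- `∑_{1 ≤ r < s} (-1) ^ (r - 1) / r • N ^ r`. -/
noncomputable def truncLog {R : Type*} [Ring R] [Algebra k R] (s : ℕ) (N : R) : R :=
  ∑ r ∈ Finset.Ico 1 s, ((-1 : k) ^ (r - 1) / (r : k)) • N ^ r

variable {k}

theorem truncExp_eq_of_le {R : Type*} [Ring R] [Algebra k R] {s t : ℕ} {N : R} (hst : s ≤ t)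
    (hN : N ^ s = 0) : truncExp k t N = truncExp k s N := by
  refine (Finset.sum_subset (by simpa using hst) fun r _ hr => ?_).symm
  rw [pow_eq_zero_of_le (by simpa using hr) hN, smul_zero]

theorem truncLog_eq_of_le {R : Type*} [Ring R] [Algebra k R] {s t : ℕ} {N : R} (hst : s ≤ t)
    (hN : N ^ s = 0) : truncLog k t N = truncLog k s N := by
  refine (Finset.sum_subset (Finset.Ico_subset_Ico_right hst) fun r h1 hr => ?_).symm
  simp only [Finset.mem_Ico] at h1 hr
  rw [pow_eq_zero_of_le (by omega) hN, smul_zero]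

theorem truncExp_zero {R : Type*} [Ring R] [Algebra k R] {s : ℕ} (hs : 0 < s) :
    truncExp k s (0 : R) = 1 := by
  obtain ⟨s, rfl⟩ := Nat.exists_eq_succ_of_ne_zero hs.ne'
  simp [truncExp, Finset.sum_range_succ']

theorem truncLog_zero {R : Type*} [Ring R] [Algebra k R] (s : ℕ) :
    truncLog k s (0 : R) = 0 := by
  refine Finset.sum_eq_zero fun r hr => ?_
  rw [zero_pow (by simp at hr; omega), smul_zero]

theorem map_truncExp {R S : Type*} [Ring R] [Algebra k R] [Ring S] [Algebra k S] (f : R →ₐ[k] S)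
    (s : ℕ) (N : R) : f (truncExp k s N) = truncExp k s (f N) := by
  simp [truncExp]

theorem map_truncLog {R S : Type*} [Ring R] [Algebra k R] [Ring S] [Algebra k S] (f : R →ₐ[k] S)
    (s : ℕ) (N : R) : f (truncLog k s N) = truncLog k s (f N) := by
  simp [truncLog]

theorem natCast_ne_zero_of_lt {p : ℕ} [CharP k p] {r : ℕ} (h0 : 0 < r) (hr : r < p) :
    (r : k) ≠ 0 := by
  rw [Ne, CharP.cast_eq_zero_iff k p]
  exact Nat.not_dvd_of_pos_of_lt h0 hr

theorem factorial_ne_zero_of_lt {p : ℕ} [CharP k p] (hp : p.Prime) {r : ℕ} (hr : r < p) :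
    (r.factorial : k) ≠ 0 := by
  rw [Ne, CharP.cast_eq_zero_iff k p, hp.dvd_factorial]
  omega

-- Both polynomials solve `(1 + X) G' = G` modulo `X ^ (p - 1)`. The recursion `(r + 1) g_{r+1} = (1
-- - r) g_r` for `r < p - 1` divides only by integers prime to `p`, so it fixes every coefficient
-- below `X ^ p` once `g_0 = 1`.
open Polynomial in
theorem X_pow_dvd_truncExp_truncLog {p : ℕ} [CharP k p] (hp : p.Prime) :
    (X : k[X]) ^ p ∣ truncExp k p (truncLog k p (X : k[X])) - (1 + X) := by
  obtain ⟨q, rfl⟩ : ∃ q, p = q + 2 := ⟨p - 2, by have := hp.two_le; omega⟩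
  set L : k[X] := truncLog k (q + 2) X with hL
  set G : k[X] := truncExp k (q + 2) L with hG
  have hXL : X ∣ L := by
    refine Finset.dvd_sum fun r hr => ?_
    rw [Algebra.smul_def]
    exact Dvd.dvd.mul_left (dvd_pow_self _ (by simp at hr; omega)) _
  have hdL : (1 + X) * derivative L = 1 - (-X) ^ (q + 1) := by
    have h1 : derivative L = ∑ i ∈ Finset.range (q + 1), (-X) ^ i := by
      rw [hL, truncLog, Finset.sum_Ico_eq_sum_range, derivative_sum]
      refine Finset.sum_congr rfl fun i hi => ?_
      have hi' : ((1 + i : ℕ) : k) ≠ 0 :=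
        natCast_ne_zero_of_lt (p := q + 2) (by omega) (by simp at hi; omega)
      rw [derivative_smul, derivative_X_pow, Nat.add_sub_cancel_left, smul_eq_C_mul, ← mul_assoc,
        ← C_mul, div_mul_cancel₀ _ hi', neg_pow (X : k[X]), C_pow, C_neg, C_1]
    have h2 := mul_neg_geom_sum (-X : k[X]) (q + 1)
    rw [h1, ← h2, sub_neg_eq_add]
  have hdG : derivative G = derivative L * truncExp k (q + 1) L := by
    rw [hG, truncExp, truncExp, Finset.sum_range_succ', derivative_add, derivative_sum,
      Finset.mul_sum]
    simp only [pow_zero, derivative_smul, derivative_one, smul_zero, add_zero]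
    refine Finset.sum_congr rfl fun i hi => ?_
    have hi' : ((i + 1 : ℕ) : k) ≠ 0 :=
      natCast_ne_zero_of_lt (p := q + 2) (by omega) (by simp at hi; omega)
    rw [derivative_pow_succ, smul_eq_C_mul, smul_eq_C_mul]
    rw [Nat.factorial_succ, Nat.cast_mul, mul_inv]
    have : (C ((i + 1 : ℕ) : k)⁻¹ : k[X]) * (C ((i : k) + 1)) = 1 := by
      rw [← C_mul, ← C_1]; congr 1; push_cast at hi' ⊢; exact inv_mul_cancel₀ hi'
    rw [C_mul]
    calc _ = ((C ((i + 1 : ℕ) : k)⁻¹ : k[X]) * (C ((i : k) + 1)))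
          * (C ((i.factorial : k)⁻¹) * L ^ i * derivative L) := by ring
      _ = _ := by rw [this]; ring
  have hGs : truncExp k (q + 1) L = G - C (((q + 1).factorial : k)⁻¹) * L ^ (q + 1) := by
    rw [hG, truncExp, truncExp, Finset.sum_range_succ _ (q + 1), smul_eq_C_mul]
    ring
  -- The error has two sources: the truncated geometric series for `L'`, and the top term `L ^ (p -
  -- 1)` lost in differentiating the exponential, which `X ∣ L` makes divisible by `X ^ (p - 1)`.
  -- Here `q + 1 = p - 1`.
  have hode : ∃ F : k[X], (1 + X) * derivative G = G + X ^ (q + 1) * F := by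
    obtain ⟨Q, hQ⟩ := hXL
    refine ⟨-(1 - (-X) ^ (q + 1)) * C (((q + 1).factorial : k)⁻¹) * Q ^ (q + 1)
      - (-1) ^ (q + 1) * G, ?_⟩
    rw [hdG, ← mul_assoc, hdL, hGs, hQ, neg_pow (X : k[X])]
    ring
  obtain ⟨F, hF⟩ := hode
  have hcoef : ∀ r, r < q + 1 → ((r : k) + 1) * G.coeff (r + 1) + r * G.coeff r = G.coeff r := by
    intro r hr
    have := congrArg (fun P => P.coeff r) hF
    simp only [coeff_add, add_mul, one_mul, coeff_derivative] at this
    rw [coeff_X_pow_mul', if_neg (by omega), add_zero] at this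
    cases r with
    | zero => simpa using this
    | succ r =>
      rw [coeff_X_mul, coeff_derivative] at this
      push_cast at this ⊢
      linear_combination this
  have h0 : G.coeff 0 = 1 := by
    have hL0 : L.coeff 0 = 0 := X_dvd_iff.mp hXL
    rw [coeff_zero_eq_aeval_zero, hG, map_truncExp, ← coeff_zero_eq_aeval_zero, hL0,
      truncExp_zero (by omega)]
  have h1 : G.coeff 1 = 1 := by
    have := hcoef 0 (by omega)
    simpa [h0] using this
  have h2 : ∀ r, r + 2 < q + 2 → G.coeff (r + 2) = 0 := by
    intro r
    induction r with
    | zero =>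
      intro hr
      have h := hcoef 1 (by omega)
      rw [h1] at h
      have hne := natCast_ne_zero_of_lt (k := k) (p := q + 2) (r := 2) (by omega) (by omega)
      have : (2 : k) * G.coeff 2 = 0 := by
        have h' := h
        norm_num at h'
        rcases h' with h' | h'
        · exact absurd h' (by simpa [one_add_one_eq_two] using hne)
        · rw [h', mul_zero]
      simpa [show (2 : k) ≠ 0 by simpa using hne] using this
    | succ r ih =>
      intro hr
      have h := hcoef (r + 2) (by omega)
      rw [ih (by omega)] at h
      have hne := natCast_ne_zero_of_lt (k := k) (p := q + 2) (r := r + 3) (by omega) (by omega)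
      have h' : ((r + 3 : ℕ) : k) * G.coeff (r + 3) = 0 := by
        rw [mul_zero, add_zero] at h
        rw [← h]
        push_cast
        ring
      exact (mul_eq_zero.mp h').resolve_left hne
  rw [X_pow_dvd_iff]
  intro r hr
  match r with
  | 0 => simp [h0]
  | 1 => simp [h1, coeff_one]
  | r + 2 => simp [h2 r hr, coeff_one, coeff_X]

theorem truncExp_truncLog {R : Type*} [Ring R] [Algebra k R] {p : ℕ} [CharP k p] (hp : p.Prime)
    {N : R} (hN : N ^ p = 0) : truncExp k p (truncLog k p N) = 1 + N := by
  obtain ⟨F, hF⟩ := X_pow_dvd_truncExp_truncLog (k := k) hp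
  have h := congrArg (Polynomial.aeval N) hF
  rw [map_sub, map_truncExp, map_truncLog, map_mul, map_pow, Polynomial.aeval_X, hN, zero_mul,
    map_add, map_one, Polynomial.aeval_X] at h
  exact sub_eq_zero.mp h

end Exp

/-! ### The derivative of the truncated exponential -/

section Deriv

variable {k : Type u} [Field k] {R : Type*} [Ring R] [Algebra k R]

/-- The sequence `0, W, [W, N], [[W, N], N], …`. -/
def adSeq (N W : R) : ℕ → R
  | 0 => 0
  | 1 => W
  | m + 2 => adSeq N W (m + 1) * N - N * adSeq N W (m + 1)

variable (k) in
/-- `∑_{m ≥ 1} [[W, N], …, N] / m!`, the logarithmic derivative of the exponential at `N` in the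
direction `W`. -/
noncomputable def expDeriv (s : ℕ) (N W : R) : R :=
  ∑ m ∈ Finset.range s, ((m.factorial : k)⁻¹) • adSeq N W m

theorem adSeq_mul (N W : R) (m : ℕ) :
    adSeq N W m * N + (if m = 0 then W else 0) = adSeq N W (m + 1) + N * adSeq N W m := by
  cases m with
  | zero => simp [adSeq]
  | succ m => simp [adSeq]

/-- For `m ≥ 1`, `adSeq N W m` is a combination of words `N ^ a * W * N ^ b` with `a + b = m - 1`;
hence the shift from `s` to `s + 1`. -/
theorem pow_mul_adSeq_mul_pow {s : ℕ} {N W : R} (h : ∀ a b, s ≤ a + b → N ^ a * W * N ^ b = 0)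
    (m : ℕ) : ∀ a b, s + 1 ≤ a + b + m → N ^ a * adSeq N W m * N ^ b = 0 := by
  induction m with
  | zero => simp [adSeq]
  | succ m ih =>
    intro a b hab
    cases m with
    | zero => exact h a b (by omega)
    | succ m =>
      have h1 := ih a (b + 1) (by omega)
      have h2 := ih (a + 1) b (by omega)
      rw [adSeq, mul_sub, sub_mul]
      rw [pow_succ' N b] at h1
      rw [pow_succ] at h2
      simp only [mul_assoc] at h1 h2 ⊢
      rw [h1, h2, sub_zero]

/-- Moving the last factor `N` to the left past an iterated commutator either leaves that commutator
alone or creates the next one: this is Pascal's recursion. The term `N ^ r * D N` of the Leibniz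
rule starts a new chain at index `1`, which is why `adSeq` is `0` at index `0`. -/
theorem map_pow_eq_sum_adSeq (D : R →ₗ[k] R) (hD : ∀ x y, D (x * y) = D x * y + x * D y) (N : R)
    (r : ℕ) :
    D (N ^ r) = ∑ x ∈ Finset.HasAntidiagonal.antidiagonal r,
      r.choose x.1 • (N ^ x.1 * adSeq N (D N) x.2) := by
  induction r with
  | zero =>
    have h := hD 1 1
    simp only [mul_one, one_mul] at h
    simpa [adSeq] using h
  | succ r ih =>
    rw [Finset.sum_antidiagonal_choose_succ_nsmul fun a b => N ^ a * adSeq N (D N) b, pow_succ, hD,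
      ih]
    have h1 : N ^ r * D N = ∑ x ∈ Finset.HasAntidiagonal.antidiagonal r,
        r.choose x.1 • (N ^ x.1 * if x.2 = 0 then D N else 0) := by
      rw [Finset.sum_eq_single (r, 0)]
      · simp
      · rintro ⟨a, b⟩ hx hne
        have hb : b ≠ 0 := by
          rintro rfl
          simp at hx
          exact hne (by simp [hx])
        simp [hb]
      · simp
    rw [h1, Finset.sum_mul, ← Finset.sum_add_distrib, ← Finset.sum_add_distrib]
    refine Finset.sum_congr rfl fun x hx => ?_
    have hs : r.choose x.2 = r.choose x.1 :=
      Nat.choose_symm_of_eq_add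
        (by simpa [add_comm] using (Finset.HasAntidiagonal.mem_antidiagonal.mp hx).symm)
    rw [hs, smul_mul_assoc, ← smul_add, ← smul_add, mul_assoc, ← mul_add, adSeq_mul, mul_add,
      pow_succ, mul_assoc]

theorem sum_range_mul_sum_range_eq {M : Type*} [AddCommMonoid M] (s : ℕ) (f : ℕ → ℕ → M)
    (hf : ∀ a b, s ≤ a + b → f a b = 0) :
    ∑ a ∈ Finset.range s, ∑ b ∈ Finset.range s, f a b
      = ∑ r ∈ Finset.range s, ∑ x ∈ Finset.HasAntidiagonal.antidiagonal r, f x.1 x.2 := by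
  rw [← Finset.sum_product', Finset.sum_sigma']
  symm
  refine Finset.sum_of_injOn (fun x => x.2) ?_ ?_ ?_ ?_
  · rintro ⟨r, a, b⟩ h1 ⟨r', a', b'⟩ h2 h
    simp at h1 h2 h
    obtain ⟨rfl, rfl⟩ := h
    simp [← h1.2, ← h2.2]
  · rintro ⟨r, a, b⟩ h
    simp at h ⊢
    omega
  · rintro ⟨a, b⟩ h1 h2
    refine hf a b ?_
    by_contra hlt
    exact h2 ⟨⟨a + b, a, b⟩, by simpa using hlt, rfl⟩
  · intros; rfl

/-- In the product on the right, the terms of total index at least `p` have no counterpart on the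
left; `hN` kills them. Below `p` the factorials are invertible and the binomial coefficients cancel.
-/
theorem map_truncExp_of_leibniz {p : ℕ} [CharP k p] (hp : p.Prime) (D : R →ₗ[k] R)
    (hD : ∀ x y, D (x * y) = D x * y + x * D y) {N : R}
    (hN : ∀ a b, p - 1 ≤ a + b → N ^ a * D N * N ^ b = 0) :
    D (truncExp k p N) = truncExp k p N * expDeriv k p N (D N) := by
  have hp1 := hp.one_le
  rw [truncExp, expDeriv, Finset.sum_mul_sum, sum_range_mul_sum_range_eq, map_sum]
  · refine Finset.sum_congr rfl fun r hr => ?_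
    rw [map_smul, map_pow_eq_sum_adSeq D hD, Finset.smul_sum]
    refine Finset.sum_congr rfl fun x hx => ?_
    rw [Finset.mem_range] at hr
    rw [Finset.HasAntidiagonal.mem_antidiagonal] at hx
    rw [smul_mul_smul_comm, ← Nat.cast_smul_eq_nsmul k, smul_smul]
    congr 1
    have h1 := factorial_ne_zero_of_lt (k := k) hp hr
    have h2 := factorial_ne_zero_of_lt (k := k) hp (r := x.1) (by omega)
    have h3 := factorial_ne_zero_of_lt (k := k) hp (r := x.2) (by omega)
    have h4 := Nat.add_choose_mul_factorial_mul_factorial x.2 x.1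
    rw [add_comm, hx] at h4
    rw [← h4] at h1 ⊢
    push_cast at h1 ⊢
    field_simp
    exact div_self (left_ne_zero_of_mul (left_ne_zero_of_mul h1))
  · intro a b hab
    have h := pow_mul_adSeq_mul_pow hN b a 0 (by omega)
    rw [pow_zero, mul_one] at h
    rw [smul_mul_smul_comm, h, smul_zero]

end Deriv

/-! ### Families of nilpotent matrices satisfying the relations of `𝔲ₙ` -/

section Relations

variable {k : Type u} [Field k]

/-- The matrices `X i j`, `i < j`, satisfy the commutation relations of the matrix units of `𝔲ₙ`;
those with `j ≤ i` vanish. -/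
structure UnitRelations {n d : ℕ} (X : Fin n → Fin n → Matrix (Fin d) (Fin d) k) : Prop where
  eq_zero : ∀ i j, j ≤ i → X i j = 0
  comm : ∀ i j, i < j → ∀ l m, l < m →
    X i j * X l m - X l m * X i j = (if j = l then X i m else 0) - (if m = i then X l j else 0)

/-- One step of the upper central series: the vectors that all `X i` send into `W`. -/
def nextStep {ι : Type*} {d : ℕ} (X : ι → Matrix (Fin d) (Fin d) k)
    (W : Submodule k (Fin d → k)) : Submodule k (Fin d → k) where
  carrier := {w | ∀ i, (X i).mulVec w ∈ W}
  add_mem' h1 h2 i := by rw [Matrix.mulVec_add]; exact W.add_mem (h1 i) (h2 i)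
  zero_mem' i := by rw [Matrix.mulVec_zero]; exact W.zero_mem
  smul_mem' c w h i := by rw [Matrix.mulVec_smul]; exact W.smul_mem c (h i)

open scoped Pointwise

/-! ### Engel's theorem for an ordered family of nilpotent matrices -/

section Flag

variable {ι : Type*} {d : ℕ} {X : ι → Matrix (Fin d) (Fin d) k} {key : ι → ℕ}

/-- Engel's argument, one matrix at a time in the order of `key`. The vectors sent into `W` by all
matrices of key below `N` are stable under every `X j`, since the relevant commutators involve only
smaller keys. So the matrix of key `N` can be applied to `v` as often as the result stays outside
`W`. -/
theorem exists_notMem_mulVec_mem (hkey : Function.Injective key) (hnil : ∀ i, IsNilpotent (X i))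
    (hcomm : ∀ i j, X i * X j - X j * X i ∈ Submodule.span k (X '' {c | key c < key i}))
    {W : Submodule k (Fin d → k)} (hW : W ≠ ⊤) (hst : ∀ i, ∀ w ∈ W, (X i).mulVec w ∈ W) (N : ℕ) :
    ∃ v, v ∉ W ∧ ∀ i, key i < N → (X i).mulVec v ∈ W := by
  induction N with
  | zero =>
    obtain ⟨v, hv⟩ := not_forall.mp fun h => hW (Submodule.eq_top_iff'.mpr h)
    exact ⟨v, hv, fun i hi => by omega⟩
  | succ N ih =>
    obtain ⟨v, hv, hvN⟩ := ih
    by_cases hN : ∃ i, key i = N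
    swap
    · refine ⟨v, hv, fun i hi => hvN i ?_⟩
      have : key i ≠ N := fun h => hN ⟨i, h⟩
      omega
    obtain ⟨i₀, hi₀⟩ := hN
    have hstab : ∀ w, (∀ i, key i < N → (X i).mulVec w ∈ W) →
        ∀ j i, key i < N → (X i).mulVec ((X j).mulVec w) ∈ W := by
      intro w hw j i hi
      have h1 : (X i).mulVec ((X j).mulVec w)
          = (X j).mulVec ((X i).mulVec w) + (X i * X j - X j * X i).mulVec w := by
        simp [Matrix.sub_mulVec]
      rw [h1]
      refine W.add_mem (hst j _ (hw i hi)) ?_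
      refine Submodule.span_induction (p := fun M _ => M.mulVec w ∈ W) ?_ ?_ ?_ ?_ (hcomm i j)
      · rintro _ ⟨c, hc, rfl⟩
        exact hw c (lt_trans hc hi)
      · simp
      · intro a b _ _ ha hb
        rw [Matrix.add_mulVec]
        exact W.add_mem ha hb
      · intro c a _ ha
        rw [Matrix.smul_mulVec]
        exact W.smul_mem c ha
    have hpow : ∀ r, ∀ i, key i < N → (X i).mulVec (((X i₀) ^ r).mulVec v) ∈ W := by
      intro r
      induction r with
      | zero => simpa using hvN
      | succ r ihr =>
        intro i hi
        rw [pow_succ', ← Matrix.mulVec_mulVec]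
        exact hstab _ ihr i₀ i hi
    have hex : ∃ r, ((X i₀) ^ r).mulVec v ∈ W := by
      obtain ⟨r, hr⟩ := hnil i₀
      exact ⟨r, by rw [hr]; simp⟩
    classical
    obtain ⟨r, hr⟩ : ∃ r, Nat.find hex = r + 1 := Nat.exists_eq_succ_of_ne_zero fun h => by
      have := Nat.find_spec hex
      rw [h] at this
      exact hv (by simpa using this)
    refine ⟨((X i₀) ^ r).mulVec v, Nat.find_min hex (by omega), fun i hi => ?_⟩
    rcases Nat.lt_succ_iff_lt_or_eq.mp hi with h | h
    · exact hpow r i h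
    · obtain rfl : i = i₀ := hkey (h.trans hi₀.symm)
      rw [Matrix.mulVec_mulVec, ← pow_succ', ← hr]
      exact Nat.find_spec hex

/-- Iterating `nextStep` from `⊥` grows strictly until it reaches `⊤`, so `d` steps suffice, and
each factor of a word descends one step. -/
theorem eq_zero_of_mem_range_pow [Finite ι] (hkey : Function.Injective key)
    (hnil : ∀ i, IsNilpotent (X i))
    (hcomm : ∀ i j, X i * X j - X j * X i ∈ Submodule.span k (X '' {c | key c < key i}))
    {w : Matrix (Fin d) (Fin d) k} (hw : w ∈ Set.range X ^ d) : w = 0 := by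
  let W : ℕ → Submodule k (Fin d → k) := fun r => (nextStep X)^[r] ⊥
  have hW : ∀ r, W (r + 1) = nextStep X (W r) := fun r => Function.iterate_succ_apply' _ _ _
  have hmono : ∀ r, W r ≤ W (r + 1) := by
    intro r
    induction r with
    | zero => exact bot_le
    | succ r ih =>
      rw [hW r, hW (r + 1)]
      exact fun v hv i => ih (hv i)
  have hstep : ∀ r, W r ≠ ⊤ → W r < W (r + 1) := by
    intro r hr
    obtain ⟨N, hN⟩ := (Set.finite_range key).bddAbove
    obtain ⟨v, hv, hvN⟩ := exists_notMem_mulVec_mem hkey hnil hcomm hr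
      (fun i w hw => by have := hmono r hw; rw [hW r] at this; exact this i) (N + 1)
    refine lt_of_le_of_ne (hmono r) fun h => hv ?_
    rw [h, hW r]
    exact fun i => hvN i (Nat.lt_succ_of_le (hN ⟨i, rfl⟩))
  have hrank : ∀ r, W r = ⊤ ∨ r ≤ Module.finrank k (W r) := by
    intro r
    induction r with
    | zero => simp
    | succ r ih =>
      by_cases h : W r = ⊤
      · left
        exact top_le_iff.mp (h ▸ hmono r)
      · right
        have := Submodule.finrank_lt_finrank_of_lt (hstep r h)
        have := ih.resolve_left h
        omega
  have htop : W d = ⊤ := by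
    rcases hrank d with h | h
    · exact h
    · refine Submodule.eq_top_of_finrank_eq (le_antisymm (Submodule.finrank_le _) ?_)
      simpa using h
  have hkill : ∀ r, ∀ w ∈ Set.range X ^ r, ∀ v ∈ W r, w.mulVec v = 0 := by
    intro r
    induction r with
    | zero =>
      intro w _ v hv
      rw [(Submodule.mem_bot k).mp hv, Matrix.mulVec_zero]
    | succ r ih =>
      intro w hw v hv
      rw [pow_succ, Set.mem_mul] at hw
      obtain ⟨w', hw', _, ⟨i, rfl⟩, rfl⟩ := hw
      rw [← Matrix.mulVec_mulVec]
      rw [hW r] at hv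
      exact ih w' hw' _ (hv i)
  refine Matrix.toLin'.injective (LinearMap.ext fun v => ?_)
  simpa using hkill d w hw v (htop ▸ trivial)

end Flag

theorem UnitRelations.eq_zero_of_mem_range_pow {n d : ℕ}
    {X : Fin n → Fin n → Matrix (Fin d) (Fin d) k} (hX : UnitRelations X)
    (hnil : ∀ i j, IsNilpotent (X i j)) {w : Matrix (Fin d) (Fin d) k}
    (hw : w ∈ Set.range (fun q : Fin n × Fin n => X q.1 q.2) ^ d) : w = 0 := by
  -- Rows are ordered from the top, and each row from right to left. A bracket with `ε_ij` yields
  -- only `ε_im` with `m > j` or `ε_lj` with `l < i`, and both come earlier.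
  refine UnipotentRep.eq_zero_of_mem_range_pow
    (key := fun q : Fin n × Fin n => (q.1 : ℕ) * n + (n - 1 - q.2)) ?_ (fun q => hnil q.1 q.2) ?_ hw
  · rintro ⟨⟨a, ha⟩, ⟨b, hb⟩⟩ ⟨⟨a', ha'⟩, ⟨b', hb'⟩⟩ h
    simp only at h
    have hn : 0 < n := by omega
    have h1 := congrArg (· / n) h
    have h2 := congrArg (· % n) h
    simp only [Nat.mul_comm _ n, Nat.mul_add_div hn,
      Nat.mul_add_mod] at h1 h2
    rw [Nat.div_eq_of_lt (by omega), Nat.div_eq_of_lt (by omega)] at h1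
    rw [Nat.mod_eq_of_lt (by omega), Nat.mod_eq_of_lt (by omega)] at h2
    simp only [Prod.mk.injEq, Fin.mk.injEq]
    omega
  · rintro ⟨i, j⟩ ⟨l, m⟩
    simp only
    by_cases hij : i < j
    swap
    · rw [hX.eq_zero i j (not_lt.mp hij)]; simp
    by_cases hlm : l < m
    swap
    · rw [hX.eq_zero l m (not_lt.mp hlm)]; simp
    rw [hX.comm i j hij l m hlm]
    refine Submodule.sub_mem _ ?_ ?_
    · split_ifs with h
      · subst h
        refine Submodule.subset_span ⟨(i, m), ?_, rfl⟩
        simp only [Set.mem_ofPred_eq, Fin.lt_def] at *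
        omega
      · exact Submodule.zero_mem _
    · split_ifs with h
      · subst h
        refine Submodule.subset_span ⟨(l, j), ?_, rfl⟩
        simp only [Set.mem_ofPred_eq, Fin.lt_def] at *
        gcongr
        omega
      · exact Submodule.zero_mem _

end Relations

/-! ### Scalar extension of a representation of `𝔲ₙ` -/

section Extension

variable {k : Type u} [Field k] {n d : ℕ} {B : Type v} [CommRing B] [Algebra k B]

/-- The `B`-linear map `Y ↦ ∑ Y_{ij} X_{ij}`. -/
noncomputable def extMat (B : Type v) [CommRing B] [Algebra k B]
    (X : Fin n → Fin n → Matrix (Fin d) (Fin d) k) :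
    Matrix (Fin n) (Fin n) B →ₗ[B] Matrix (Fin d) (Fin d) B where
  toFun Y := ∑ i, ∑ j, Y i j • (X i j).map (algebraMap k B)
  map_add' Y Z := by simp only [Matrix.add_apply, add_smul, Finset.sum_add_distrib]
  map_smul' c Y := by
    simp only [Matrix.smul_apply, smul_eq_mul, mul_smul, Finset.smul_sum, RingHom.id_apply]

variable {X X' : Fin n → Fin n → Matrix (Fin d) (Fin d) k}

theorem extMat_apply (Y : Matrix (Fin n) (Fin n) B) :
    extMat B X Y = ∑ i, ∑ j, Y i j • (X i j).map (algebraMap k B) := rfl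

theorem extMat_map {C : Type*} [CommRing C] [Algebra k C] (f : B →ₐ[k] C)
    (Y : Matrix (Fin n) (Fin n) B) : (extMat B X Y).map f = extMat C X (Y.map f) := by
  rw [extMat_apply, extMat_apply]
  change f.mapMatrix _ = _
  simp only [map_sum]
  refine Finset.sum_congr rfl fun i _ => Finset.sum_congr rfl fun j _ => ?_
  ext a b
  simp

theorem extMat_single (i j : Fin n) (b : B) :
    extMat B X (Matrix.single i j b) = b • (X i j).map (algebraMap k B) := by
  rw [extMat_apply, Finset.sum_eq_single i, Finset.sum_eq_single j]
  · simp
  · intro l _ hl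
    rw [Matrix.single_apply_of_ne _ _ _ _ _ (by tauto), zero_smul]
  · simp
  · intro l _ hl
    refine Finset.sum_eq_zero fun m _ => ?_
    rw [Matrix.single_apply_of_ne _ _ _ _ _ (by tauto), zero_smul]
  · simp

theorem commute_extMat (h : ∀ i j l m, Commute (X i j) (X' l m))
    (Y Z : Matrix (Fin n) (Fin n) B) : Commute (extMat B X Y) (extMat B X' Z) := by
  rw [extMat_apply, extMat_apply]
  refine Commute.sum_left _ _ _ fun i _ => Commute.sum_left _ _ _ fun j _ =>
    Commute.sum_right _ _ _ fun l _ => Commute.sum_right _ _ _ fun m _ => ?_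
  exact (((h i j l m).map (algebraMap k B).mapMatrix).smul_left _).smul_right _

theorem HeightGE.apply_eq_zero {M : Matrix (Fin n) (Fin n) B} (hM : HeightGE 1 M) {i j : Fin n}
    (h : ¬ i < j) : M i j = 0 :=
  hM i j (by rw [Fin.lt_def] at h; omega)

theorem extMat_bracket (hX : UnitRelations X) {Y Z : Matrix (Fin n) (Fin n) B}
    (hY : HeightGE 1 Y) (hZ : HeightGE 1 Z) :
    extMat B X (Y * Z - Z * Y) = extMat B X Y * extMat B X Z - extMat B X Z * extMat B X Y := by
  set x : Fin n → Fin n → Matrix (Fin d) (Fin d) B := fun i j => (X i j).map (algebraMap k B)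
    with hx
  have hcomm : ∀ i j, i < j → ∀ l m, l < m →
      x i j * x l m - x l m * x i j
        = (if j = l then x i m else 0) - (if m = i then x l j else 0) := by
    intro i j hij l m hlm
    have h := congrArg (algebraMap k B).mapMatrix (hX.comm i j hij l m hlm)
    rw [map_sub, map_sub, map_mul, map_mul, apply_ite (algebraMap k B).mapMatrix,
      apply_ite (algebraMap k B).mapMatrix, map_zero] at h
    exact h
  have hR : extMat B X Y * extMat B X Z - extMat B X Z * extMat B X Y
      = ∑ i, ∑ j, ∑ l, ∑ m, (Y i j * Z l m) •
          ((if j = l then x i m else 0) - (if m = i then x l j else 0)) := by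
    have hprod : ∀ Y : Matrix (Fin n) (Fin n) B,
        extMat B X Y = ∑ q : Fin n × Fin n, Y q.1 q.2 • x q.1 q.2 := fun Y => by
      rw [Fintype.sum_prod_type, extMat_apply]
    have h1 : extMat B X Y * extMat B X Z
        = ∑ i, ∑ j, ∑ l, ∑ m, (Y i j * Z l m) • (x i j * x l m) := by
      rw [hprod, hprod, Finset.sum_mul_sum]
      simp only [smul_mul_smul_comm, Fintype.sum_prod_type]
    have h2 : extMat B X Z * extMat B X Y
        = ∑ i, ∑ j, ∑ l, ∑ m, (Y i j * Z l m) • (x l m * x i j) := by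
      rw [hprod, hprod, Finset.sum_mul_sum, Finset.sum_comm]
      simp only [smul_mul_smul_comm, Fintype.sum_prod_type, mul_comm (Z _ _)]
    rw [h1, h2]
    simp only [← Finset.sum_sub_distrib, ← smul_sub]
    refine Finset.sum_congr rfl fun i _ => Finset.sum_congr rfl fun j _ =>
      Finset.sum_congr rfl fun l _ => Finset.sum_congr rfl fun m _ => ?_
    by_cases hij : i < j
    swap
    · rw [hY.apply_eq_zero hij, zero_mul, zero_smul, zero_smul]
    by_cases hlm : l < m
    swap
    · rw [hZ.apply_eq_zero hlm, mul_zero, zero_smul, zero_smul]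
    rw [hcomm i j hij l m hlm]
  rw [hR, map_sub]
  simp only [smul_sub, Finset.sum_sub_distrib, smul_ite, smul_zero]
  congr 1
  · rw [extMat_apply]
    refine Finset.sum_congr rfl fun i _ => ?_
    simp only [Matrix.mul_apply, Finset.sum_smul]
    rw [Finset.sum_comm]
    refine Finset.sum_congr rfl fun j _ => ?_
    rw [Finset.sum_comm]
    simp [hx]
  · rw [extMat_apply]
    simp only [Finset.sum_ite_eq', Finset.mem_univ, if_true, Matrix.mul_apply, Finset.sum_smul]
    refine (Finset.sum_congr rfl fun l _ => Finset.sum_comm).trans ?_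
    rw [Finset.sum_comm]
    refine Finset.sum_congr rfl fun i _ => ?_
    rw [Finset.sum_comm]
    simp only [mul_comm (Z _ _), hx]

/-- The power expands into words of length `d` in the `X i j`, and all such words vanish. Nilpotency
of each generator alone would not suffice. -/
theorem extMat_pow_eq_zero (hX : UnitRelations X) (hnil : ∀ i j, IsNilpotent (X i j))
    (Y : Matrix (Fin n) (Fin n) B) : extMat B X Y ^ d = 0 := by
  open scoped Pointwise in
  set S : Set (Matrix (Fin d) (Fin d) k) := Set.range (fun q : Fin n × Fin n => X q.1 q.2) with hS
  have h1 : extMat B X Y ∈ Submodule.span B ((algebraMap k B).mapMatrix '' S) := by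
    rw [extMat_apply]
    refine Submodule.sum_mem _ fun i _ => Submodule.sum_mem _ fun j _ => Submodule.smul_mem _ _ ?_
    exact Submodule.subset_span ⟨X i j, ⟨(i, j), rfl⟩, rfl⟩
  have h2 := Submodule.pow_mem_pow _ h1 d
  rw [Submodule.span_pow, ← Set.image_pow] at h2
  refine (Submodule.mem_bot B).mp (Submodule.span_le.mpr ?_ h2)
  rintro _ ⟨w, hw, rfl⟩
  rw [hX.eq_zero_of_mem_range_pow hnil hw, map_zero]
  exact Submodule.zero_mem _

theorem HeightGE.adSeq {N W : Matrix (Fin n) (Fin n) B} (hN : HeightGE 1 N) (hW : HeightGE 1 W)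
    (m : ℕ) : HeightGE 1 (adSeq N W m) := by
  induction m with
  | zero => exact HeightGE.zero 1
  | succ m ih =>
    cases m with
    | zero => exact hW
    | succ m => exact ((ih.mul hN).mono (by omega)).sub ((hN.mul ih).mono (by omega))

theorem extMat_adSeq (hX : UnitRelations X) {N W : Matrix (Fin n) (Fin n) B}
    (hN : HeightGE 1 N) (hW : HeightGE 1 W) (m : ℕ) :
    extMat B X (adSeq N W m) = adSeq (extMat B X N) (extMat B X W) m := by
  induction m with
  | zero => exact map_zero _
  | succ m ih =>
    cases m with
    | zero => rfl
    | succ m => rw [adSeq, extMat_bracket hX (hN.adSeq hW _) hN, ih, adSeq]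

theorem extMat_expDeriv (hX : UnitRelations X) {N W : Matrix (Fin n) (Fin n) B}
    (hN : HeightGE 1 N) (hW : HeightGE 1 W) (s : ℕ) :
    extMat B X (expDeriv k s N W) = expDeriv k s (extMat B X N) (extMat B X W) := by
  rw [expDeriv, expDeriv, map_sum]
  refine Finset.sum_congr rfl fun m _ => ?_
  rw [LinearMap.map_smul_of_tower, extMat_adSeq hX hN hW]

end Extension

/-! ### Unipotent upper triangular matrices -/

/-- `U` is unipotent upper triangular. -/
def IsUnip {B : Type*} [Ring B] {n : ℕ} (U : Matrix (Fin n) (Fin n) B) : Prop := HeightGE 1 (U - 1)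

namespace IsUnip

variable {B : Type*} [CommRing B] {n : ℕ} {U U' : Matrix (Fin n) (Fin n) B}

theorem one : IsUnip (1 : Matrix (Fin n) (Fin n) B) := by
  rw [IsUnip, sub_self]; exact HeightGE.zero 1

theorem heightGE_zero (hU : IsUnip U) : HeightGE 0 U := by
  have h := (HeightGE.mono hU (Nat.zero_le 1)).add HeightGE.one
  rwa [sub_add_cancel] at h

theorem mul (hU : IsUnip U) (hU' : IsUnip U') : IsUnip (U * U') := by
  have h : U * U' - 1 = U * (U' - 1) + (U - 1) := by noncomm_ring
  rw [IsUnip, h]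
  exact ((hU.heightGE_zero.mul hU').mono (by omega)).add hU

theorem one_add {Y : Matrix (Fin n) (Fin n) B} (hY : HeightGE 1 Y) : IsUnip (1 + Y) := by
  rwa [IsUnip, add_sub_cancel_left]

theorem map {C : Type*} [CommRing C] (f : B →+* C) (hU : IsUnip U) : IsUnip (U.map f) := by
  have h := HeightGE.map hU f (map_zero f)
  rwa [Matrix.map_sub _ (map_sub f), Matrix.map_one _ (map_zero f) (map_one f)] at h

theorem isUnit (hU : IsUnip U) : IsUnit U := by
  have h := IsNilpotent.isUnit_one_add (r := U - 1) ⟨n, (HeightGE.pow hU n).eq_zero le_rfl⟩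
  rwa [add_sub_cancel] at h

theorem heightGE_single (q : Pos n) (b : B) : HeightGE 1 (Matrix.single q.1.1 q.1.2 b) := by
  intro i j hij
  refine Matrix.single_apply_of_ne _ _ _ _ _ ?_
  rintro ⟨rfl, rfl⟩
  have := q.2
  rw [Fin.lt_def] at this
  omega

theorem elementary (q : Pos n) (b : B) : IsUnip (1 + Matrix.single q.1.1 q.1.2 b) :=
  one_add (heightGE_single q b)

/-- Every unipotent upper triangular matrix is a product of elementary ones. -/
theorem induction {P : Matrix (Fin n) (Fin n) B → Prop} (h1 : P 1)
    (hmul : ∀ U, IsUnip U → P U → ∀ (q : Pos n) (b : B),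
      P (U * (1 + Matrix.single q.1.1 q.1.2 b))) (hU : IsUnip U) : P U := by
  have key : ∀ S : Finset (Pos n),
      IsUnip (1 + ∑ q ∈ S, Matrix.single q.1.1 q.1.2 (U q.1.1 q.1.2)) ∧
        P (1 + ∑ q ∈ S, Matrix.single q.1.1 q.1.2 (U q.1.1 q.1.2)) := by
    intro S
    refine ⟨one_add (HeightGE.sum fun q _ => heightGE_single q _), ?_⟩
    -- Each new factor has minimal row index among those used so far, so its product with the
    -- earlier matrix units vanishes and multiplying by it merely adds one entry.
    induction S using Finset.induction_on_min_value (fun q : Pos n => q.1.1) with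
    | empty => simpa using h1
    | insert q S hq hmin ih =>
      have h := hmul _ (one_add (HeightGE.sum fun q _ => heightGE_single q _)) ih q (U q.1.1 q.1.2)
      convert h using 1
      have h0 : (∑ r ∈ S, Matrix.single r.1.1 r.1.2 (U r.1.1 r.1.2))
          * Matrix.single q.1.1 q.1.2 (U q.1.1 q.1.2) = 0 := by
        rw [Finset.sum_mul]
        exact Finset.sum_eq_zero fun r hr =>
          Matrix.single_mul_single_of_ne _ _ _ _ ((hmin r hr).trans_lt r.2).ne' _
      rw [Finset.sum_insert hq, mul_add, mul_one, add_mul, one_mul, h0]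
      abel
  convert (key Finset.univ).2
  ext i j
  rw [Matrix.add_apply, Matrix.sum_apply]
  by_cases hij : i < j
  · rw [Finset.sum_eq_single ⟨(i, j), hij⟩]
    · simp [hij.ne]
    · rintro q _ hq
      refine Matrix.single_apply_of_ne _ _ _ _ _ ?_
      rintro ⟨rfl, rfl⟩
      exact hq rfl
    · simp
  · rw [Finset.sum_eq_zero, add_zero]
    · exact sub_eq_zero.mp (HeightGE.apply_eq_zero hU hij)
    · rintro q _
      refine Matrix.single_apply_of_ne _ _ _ _ _ ?_
      rintro ⟨rfl, rfl⟩
      exact hij q.2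

end IsUnip

/-! ### Multiplicativity of `U ↦ exp (φ (log U))` -/

section GroupExp

variable {k : Type u} [Field k] {n d : ℕ} {B : Type v} [CommRing B] [Algebra k B]
  {X X' : Fin n → Fin n → Matrix (Fin d) (Fin d) k}

/-- `exp (φ (log U))`, where `φ` is the linear map with values `X i j` at the matrix units. -/
noncomputable def groupExp (B : Type v) [CommRing B] [Algebra k B]
    (X : Fin n → Fin n → Matrix (Fin d) (Fin d) k) (U : Matrix (Fin n) (Fin n) B) :
    Matrix (Fin d) (Fin d) B :=
  truncExp k d (extMat B X (truncLog k n (U - 1)))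

theorem groupExp_map {C : Type*} [CommRing C] [Algebra k C] (f : B →ₐ[k] C)
    (U : Matrix (Fin n) (Fin n) B) : (groupExp B X U).map f = groupExp C X (U.map f) := by
  change f.mapMatrix _ = _
  rw [groupExp, groupExp, map_truncExp]
  change truncExp k d ((extMat B X _).map f) = truncExp k d (extMat C X _)
  rw [extMat_map]
  change truncExp k d (extMat C X (f.mapMatrix _)) = _
  rw [map_truncLog, map_sub, map_one]
  rfl

theorem groupExp_one (X : Fin n → Fin n → Matrix (Fin d) (Fin d) k) : groupExp B X 1 = 1 := by
  rcases Nat.eq_zero_or_pos d with rfl | hd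
  · exact Subsingleton.elim _ _
  · rw [groupExp, sub_self, truncLog_zero, map_zero, truncExp_zero hd]

theorem _root_.Commute.truncExp {R : Type*} [Ring R] [Algebra k R] {a b : R} (h : Commute a b)
    (s t : ℕ) : Commute (truncExp k s a) (truncExp k t b) :=
  Commute.sum_left _ _ _ fun _ _ => Commute.sum_right _ _ _ fun _ _ =>
    ((h.pow_pow _ _).smul_left _).smul_right _

theorem commute_groupExp (h : ∀ i j l m, Commute (X i j) (X' l m))
    (U V : Matrix (Fin n) (Fin n) B) : Commute (groupExp B X U) (groupExp B X' V) :=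
  (commute_extMat h _ _).truncExp _ _

open Polynomial

/-- The entrywise derivative of a matrix of polynomials. -/
noncomputable def derivMat (k : Type u) [Field k] (m : ℕ) (B : Type v) [CommRing B] [Algebra k B] :
    Matrix (Fin m) (Fin m) B[X] →ₗ[k] Matrix (Fin m) (Fin m) B[X] :=
  ((derivative : B[X] →ₗ[B] B[X]).restrictScalars k).mapMatrix

theorem derivMat_apply {m : ℕ} (M : Matrix (Fin m) (Fin m) B[X]) :
    derivMat k m B M = M.map derivative := rfl

theorem derivMat_mul {m : ℕ} (M N : Matrix (Fin m) (Fin m) B[X]) :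
    derivMat k m B (M * N) = derivMat k m B M * N + M * derivMat k m B N := by
  ext1 i j
  simp only [derivMat_apply, Matrix.map_apply, Matrix.mul_apply, Matrix.add_apply, derivative_sum,
    derivative_mul, Finset.sum_add_distrib]

theorem derivMat_extMat (Y : Matrix (Fin n) (Fin n) B[X]) :
    derivMat k d B (extMat B[X] X Y) = extMat B[X] X (derivMat k n B Y) := by
  ext1 a b
  rw [derivMat_apply, Matrix.map_apply, extMat_apply, extMat_apply]
  simp only [Matrix.sum_apply, derivative_sum, Matrix.smul_apply, Matrix.map_apply, smul_eq_mul,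
    derivative_mul, derivMat_apply]
  refine Finset.sum_congr rfl fun i _ => Finset.sum_congr rfl fun j _ => ?_
  rw [IsScalarTower.algebraMap_apply k B B[X], Polynomial.algebraMap_apply]
  simp

/-- All entries of `M` have degree at most `r`. -/
def DegreeLE {m m' : ℕ} (r : ℕ) (M : Matrix (Fin m) (Fin m') B[X]) : Prop :=
  ∀ i j, (M i j).natDegree ≤ r

namespace DegreeLE

variable {m : ℕ} {M N : Matrix (Fin m) (Fin m) B[X]} {r s : ℕ}

theorem mono (hM : DegreeLE r M) (h : r ≤ s) : DegreeLE s M := fun i j => (hM i j).trans h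

theorem smul (c : k) (hM : DegreeLE r M) : DegreeLE r (c • M) := fun i j =>
  (natDegree_smul_le c (M i j)).trans (hM i j)

theorem sum {ι : Type*} {t : Finset ι} {f : ι → Matrix (Fin m) (Fin m) B[X]}
    (hf : ∀ x ∈ t, DegreeLE r (f x)) : DegreeLE r (∑ x ∈ t, f x) := fun i j => by
  rw [Matrix.sum_apply]
  exact natDegree_sum_le_of_forall_le _ _ fun x hx => hf x hx i j

theorem mul (hM : DegreeLE r M) (hN : DegreeLE s N) : DegreeLE (r + s) (M * N) := fun i j => by
  rw [Matrix.mul_apply]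
  exact natDegree_sum_le_of_forall_le _ _ fun l _ =>
    natDegree_mul_le.trans (add_le_add (hM i l) (hN l j))

theorem pow (hM : DegreeLE 1 M) (r : ℕ) : DegreeLE r (M ^ r) := by
  induction r with
  | zero =>
    intro i j
    rw [pow_zero, Matrix.one_apply]
    split_ifs <;> simp
  | succ r ih => rw [pow_succ]; exact ih.mul hM

theorem extMat {Y : Matrix (Fin n) (Fin n) B[X]} (hY : DegreeLE r Y)
    (X : Fin n → Fin n → Matrix (Fin d) (Fin d) k) : DegreeLE r (extMat B[X] X Y) := by
  rw [extMat_apply]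
  refine sum fun i _ => sum fun j _ => fun a b => ?_
  rw [Matrix.smul_apply, smul_eq_mul, Matrix.map_apply, IsScalarTower.algebraMap_apply k B B[X],
    Polynomial.algebraMap_apply]
  exact (natDegree_mul_C_le _ _).trans (hY i j)

end DegreeLE

theorem add_smul_mul_add_smul {S R : Type*} [CommRing S] [Ring R] [Algebra S R] (t : S)
    (a b c e : R) (h : b * e = 0) :
    (a + t • b) * (c + t • e) = a * c + t • (a * e + b * c) := by
  rw [add_mul, mul_add, mul_add, smul_mul_smul_comm, h, smul_zero, add_zero, smul_add,
    mul_smul_comm, smul_mul_assoc, add_assoc]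

/-- `log (U (1 + tY))` is of degree at most `1` in `t` when `Y M Y = 0` for all upper triangular
`M`. -/
theorem degreeLE_truncLog {U Y : Matrix (Fin n) (Fin n) B} (hU : IsUnip U)
    (hYY : ∀ M, HeightGE 0 M → Y * M * Y = 0) (s : ℕ) :
    DegreeLE 1 (truncLog k s
      (U.map C * (1 + (Polynomial.X : B[X]) • Y.map C) - 1)) := by
  -- The condition `A * M * Y = 0` records that every term of `A` already contains a `Y`; it is what
  -- excludes a `t ^ 2` term at the next power.
  have hpow : ∀ r, ∃ A : Matrix (Fin n) (Fin n) B,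
      (U.map C * (1 + (Polynomial.X : B[X]) • Y.map C) - 1) ^ r
        = ((U - 1) ^ r).map C + (Polynomial.X : B[X]) • A.map C ∧
      ∀ M, HeightGE 0 M → A * M * Y = 0 := by
    intro r
    have hbase : U.map C * (1 + (Polynomial.X : B[X]) • Y.map C) - 1
        = (U - 1).map C + (Polynomial.X : B[X]) • (U * Y).map C := by
      rw [mul_add, mul_one, mul_smul_comm, Matrix.map_mul, Matrix.map_sub _ (map_sub C),
        Matrix.map_one _ (map_zero C) (map_one C)]
      abel
    induction r with
    | zero => exact ⟨0, by simp [Matrix.map_one _ (map_zero C) (map_one C)], by simp⟩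
    | succ r ih =>
      obtain ⟨A, hA, hAY⟩ := ih
      refine ⟨(U - 1) ^ r * (U * Y) + A * (U - 1), ?_, fun M hM => ?_⟩
      · have h0 : A.map C * (U * Y).map C = (0 : Matrix (Fin n) (Fin n) B[X]) := by
          rw [← Matrix.map_mul, ← mul_assoc, hAY U hU.heightGE_zero, Matrix.map_zero _ (map_zero C)]
        rw [pow_succ, hA, hbase, add_smul_mul_add_smul _ _ _ _ _ h0, pow_succ (U - 1),
          Matrix.map_add _ (map_add C)]
        simp only [Matrix.map_mul]
      · have h1 : U * Y * M * Y = 0 := by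
          rw [mul_assoc U, mul_assoc U, hYY M hM, mul_zero]
        have h2 := hAY ((U - 1) * M) ((HeightGE.mul hU hM).mono (by omega))
        rw [add_mul, add_mul, mul_assoc A, h2, mul_assoc, mul_assoc, ← mul_assoc (U * Y), h1,
          mul_zero, add_zero]
  refine DegreeLE.sum fun r _ => DegreeLE.smul _ ?_
  obtain ⟨A, hA, -⟩ := hpow r
  rw [hA]
  intro i j
  simp only [Matrix.add_apply, Matrix.map_apply, Matrix.smul_apply, smul_eq_mul]
  refine natDegree_add_le_of_degree_le (by simp) ?_
  exact (natDegree_mul_C_le _ _).trans natDegree_X_le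

theorem HeightGE.truncLog {N : Matrix (Fin n) (Fin n) B} (hN : HeightGE 1 N) (s : ℕ) :
    HeightGE 1 (truncLog k s N) :=
  HeightGE.sum fun r hr => ((hN.pow r).mono (Finset.mem_Ico.mp hr).1).smul _

theorem groupExp_mul_one_add {p : ℕ} [CharP k p] (hp : p.Prime) (hn : n ≤ p) (hd : 2 * d ≤ p)
    (hX : UnitRelations X) (hnil : ∀ i j, IsNilpotent (X i j))
    {U Y : Matrix (Fin n) (Fin n) B} (hU : IsUnip U) (hY : HeightGE 1 Y)
    (hYY : ∀ M, HeightGE 0 M → Y * M * Y = 0) :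
    groupExp B X (U * (1 + Y)) = groupExp B X U * truncExp k d (extMat B X Y) := by
  rcases Nat.eq_zero_or_pos d with rfl | hd0
  · exact Subsingleton.elim _ _
  have hp2 := hp.two_le
  set T : B[X] := Polynomial.X with hT
  set Y' : Matrix (Fin n) (Fin n) B[X] := Y.map C with hY'
  set V : Matrix (Fin n) (Fin n) B[X] := U.map C * (1 + T • Y') with hV
  set Z := truncLog k n (V - 1) with hZ
  set W := truncExp k d (extMat B[X] X Z) with hW
  set f := extMat B X Y with hf
  have hY'1 : HeightGE 1 Y' := hY.map C (map_zero C)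
  have hVu : IsUnip V := (hU.map C).mul (IsUnip.one_add (hY'1.smul T))
  have hVn : (V - 1) ^ n = 0 := (HeightGE.pow hVu n).eq_zero le_rfl
  have hZ1 : HeightGE 1 Z := HeightGE.truncLog hVu n
  have hexpZ : truncExp k p Z = V := by
    rw [hZ, ← truncLog_eq_of_le hn hVn, truncExp_truncLog hp (pow_eq_zero_of_le hn hVn),
      add_sub_cancel]
  have hDZ1 : HeightGE 1 (derivMat k n B Z) := hZ1.map _ (map_zero _)
  have hDV : derivMat k n B V = V * Y' := by
    have hDC : ∀ M : Matrix (Fin n) (Fin n) B, derivMat k n B (M.map C) = 0 := fun M => by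
      ext1 i j; simp [derivMat_apply]
    have hDT : derivMat k n B (T • Y') = Y' := by
      ext1 i j; simp [derivMat_apply, hT, hY']
    have hD1 : derivMat k n B 1 = 0 := by
      ext1 i j; simp [derivMat_apply, Matrix.one_apply, apply_ite derivative]
    have hYsq : Y' * Y' = 0 := by
      have := hYY 1 HeightGE.one
      rw [mul_one] at this
      rw [hY', ← Matrix.map_mul, this, Matrix.map_zero _ (map_zero C)]
    rw [hV, derivMat_mul, hDC, zero_mul, zero_add, map_add, hD1, zero_add, hDT, mul_assoc, add_mul,
      one_mul, smul_mul_assoc, hYsq, smul_zero, add_zero]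
  -- The logarithmic derivative of `exp Z = V` is `V⁻¹ V'`, and `V' = V Y'`.
  have hψ : expDeriv k p Z (derivMat k n B Z) = Y' := by
    have h := map_truncExp_of_leibniz hp (derivMat k n B) derivMat_mul (N := Z) (fun a b hab =>
      (((hZ1.pow a).mul hDZ1).mul (hZ1.pow b)).eq_zero (by omega))
    rw [hexpZ, hDV] at h
    exact (hVu.isUnit.mul_left_cancel h).symm
  have hEd : extMat B[X] X Z ^ d = 0 := extMat_pow_eq_zero hX hnil Z
  -- The commutator series passes through `φ`. Of two exponents with sum at least `p - 1 ≥ 2d - 1`,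
  -- one is at least `d`, so the derivative formula applies to `φ(Z)`.
  have hDW : derivMat k d B W = W * f.map C := by
    have h := map_truncExp_of_leibniz hp (derivMat k d B) derivMat_mul (N := extMat B[X] X Z)
      (fun a b hab => by
        rcases le_or_gt d a with ha | ha
        · rw [pow_eq_zero_of_le ha hEd, zero_mul, zero_mul]
        · rw [pow_eq_zero_of_le (m := d) (n := b) (by omega) hEd, mul_zero])
    rw [truncExp_eq_of_le (by omega) hEd, derivMat_extMat, ← extMat_expDeriv hX hZ1 hDZ1, hψ] at h
    rw [hW, h, hf]
    congr 1
    exact (extMat_map (X := X) ((CAlgHom : B →ₐ[B] B[X]).restrictScalars k) Y).symm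
  have hdeg : DegreeLE (d - 1) W := DegreeLE.sum fun r hr =>
    DegreeLE.smul _ ((((degreeLE_truncLog hU hYY n).extMat X).pow r).mono
      (by rw [Finset.mem_range] at hr; omega))
  -- The equation `W' = W f` determines the coefficients as long as `r + 1 < p` can be divided by;
  -- `hdeg` says that these are all the coefficients.
  have hcoeff : ∀ r, r < p → W.map (fun P => P.coeff r)
      = ((r.factorial : k)⁻¹) • (W.map (fun P => P.coeff 0) * f ^ r) := by
    intro r
    induction r with
    | zero => intro _; simp
    | succ r ih =>
      intro hr
      have h1 : ((r + 1 : ℕ) : k) • W.map (fun P => P.coeff (r + 1))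
          = W.map (fun P => P.coeff r) * f := by
        ext i j
        have h := congrArg (fun M => (M i j).coeff r) hDW
        simp only [derivMat_apply, Matrix.map_apply, coeff_derivative, Matrix.mul_apply,
          finsetSum_coeff, coeff_mul_C] at h
        rw [Matrix.mul_apply, Matrix.smul_apply, Algebra.smul_def, map_natCast]
        simp only [Matrix.map_apply]
        rw [← h]
        push_cast
        ring
      have hne := natCast_ne_zero_of_lt (k := k) (p := p) (r := r + 1) (by omega) hr
      rw [ih (by omega), smul_mul_assoc, mul_assoc, ← pow_succ] at h1
      rw [Nat.factorial_succ, Nat.cast_mul, mul_inv, mul_smul, ← h1, smul_smul,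
        inv_mul_cancel₀ hne, one_smul]
  have hev : ∀ b : B, W.map (Polynomial.eval b)
      = groupExp B X (U * (1 + b • Y)) := by
    intro b
    let ev : B[X] →ₐ[k] B := (Polynomial.aeval b).restrictScalars k
    have h := groupExp_map (X := X) ev V
    have hVev : V.map ev = U * (1 + b • Y) := by
      change ev.mapMatrix V = _
      rw [hV, map_mul, map_add, map_one]
      congr 1
      · ext i j; simp [ev]
      · congr 1; ext i j; simp [ev, hT, hY', mul_comm b]
    rw [hVev] at h
    rw [← h]
    ext i j
    simp [ev, hW, groupExp, hZ]
  have h0 : W.map (fun P => P.coeff 0) = groupExp B X U := by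
    have h := hev 0
    rw [zero_smul, add_zero, mul_one] at h
    rw [← h]
    ext i j
    simp [coeff_zero_eq_eval_zero]
  have h1 := hev 1
  rw [one_smul] at h1
  rw [← h1, ← h0, truncExp, Finset.mul_sum]
  ext i j
  rw [Matrix.map_apply, eval_eq_sum_range' (n := d) (by have := hdeg i j; omega), Matrix.sum_apply]
  refine Finset.sum_congr rfl fun r hr => ?_
  rw [mul_smul_comm, ← hcoeff r (by rw [Finset.mem_range] at hr; omega)]
  simp

theorem groupExp_elementary {p : ℕ} [CharP k p] (hp : p.Prime) (hn : n ≤ p) (hd : 2 * d ≤ p)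
    (hX : UnitRelations X) (hnil : ∀ i j, IsNilpotent (X i j))
    {U : Matrix (Fin n) (Fin n) B} (hU : IsUnip U) (q : Pos n) (b : B) :
    groupExp B X (U * (1 + Matrix.single q.1.1 q.1.2 b))
      = groupExp B X U * truncExp k d (b • (X q.1.1 q.1.2).map (algebraMap k B)) := by
  rw [groupExp_mul_one_add hp hn hd hX hnil hU (IsUnip.heightGE_single q b), extMat_single]
  intro M hM
  -- The product involves only the entry of `M` at `(j, i)`, which lies below the diagonal.
  rw [Matrix.single_mul_mul_single]
  have := q.2
  rw [Fin.lt_def] at this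
  rw [hM _ _ (by omega), mul_zero, zero_mul, Matrix.single_zero]

theorem groupExp_mul {p : ℕ} [CharP k p] (hp : p.Prime) (hn : n ≤ p) (hd : 2 * d ≤ p)
    (hX : UnitRelations X) (hnil : ∀ i j, IsNilpotent (X i j))
    {U V : Matrix (Fin n) (Fin n) B} (hU : IsUnip U) (hV : IsUnip V) :
    groupExp B X (U * V) = groupExp B X U * groupExp B X V := by
  refine IsUnip.induction (P := fun V => groupExp B X (U * V) = groupExp B X U * groupExp B X V)
    ?_ (fun V hV ih q b => ?_) hV
  · rw [mul_one, groupExp_one, mul_one]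
  · rw [← mul_assoc, groupExp_elementary hp hn hd hX hnil (hU.mul hV), ih,
      groupExp_elementary hp hn hd hX hnil hV, mul_assoc]

end GroupExp

/-! ### Representations of `Uₙ` as homomorphisms on points -/

section Points

variable {k : Type u} [Field k] {n d : ℕ}

/-- Evaluation of coordinate functions at a point `U` of `Uₙ`. -/
noncomputable def evalAt (k : Type u) [Field k] {B : Type v} [CommRing B] [Algebra k B]
    (U : Matrix (Fin n) (Fin n) B) : Coord k n →ₐ[k] B :=
  MvPolynomial.aeval fun q : Pos n => U q.1.1 q.1.2

/-- The matrix `a` over `Aₙ` defines group homomorphisms `Uₙ(B) → GL_d(B)` for all commutative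
`k`-algebras `B`. -/
structure IsPointwiseHom (a : Matrix (Fin d) (Fin d) (Coord k n)) : Prop where
  mul : ∀ (B : Type u) [CommRing B] [Algebra k B] (U V : Matrix (Fin n) (Fin n) B),
    IsUnip U → IsUnip V → a.map (evalAt k (U * V)) = a.map (evalAt k U) * a.map (evalAt k V)
  one : a.map (evalAt k (1 : Matrix (Fin n) (Fin n) k)) = 1

theorem comp_evalAt {B C : Type*} [CommRing B] [Algebra k B] [CommRing C] [Algebra k C]
    (f : B →ₐ[k] C) (U : Matrix (Fin n) (Fin n) B) :
    f.comp (evalAt k U) = evalAt k (U.map f) := by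
  refine MvPolynomial.algHom_ext fun q => ?_
  simp [evalAt]

theorem map_evalAt_map {B C : Type*} [CommRing B] [Algebra k B] [CommRing C] [Algebra k C]
    (f : B →ₐ[k] C) (U : Matrix (Fin n) (Fin n) B) (a : Matrix (Fin d) (Fin d) (Coord k n)) :
    (a.map (evalAt k U)).map f = a.map (evalAt k (U.map f)) := by
  rw [← comp_evalAt, Matrix.map_map]
  rfl

theorem isUnip_generic : IsUnip (generic k n) := by
  refine IsUnip.one_add fun i j hij => ?_
  rw [Matrix.of_apply, coordFn, dif_neg]
  rw [Fin.lt_def]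
  omega

theorem generic_map_evalAt {B : Type*} [CommRing B] [Algebra k B]
    {U : Matrix (Fin n) (Fin n) B} (hU : IsUnip U) : (generic k n).map (evalAt k U) = U := by
  ext i j
  rw [Matrix.map_apply, generic, Matrix.add_apply, Matrix.of_apply, coordFn, map_add]
  by_cases hij : i < j
  · rw [dif_pos hij, Matrix.one_apply_ne hij.ne, map_zero, zero_add, evalAt, MvPolynomial.aeval_X]
  · rw [dif_neg hij, map_zero, add_zero]
    have h := sub_eq_zero.mp (HeightGE.apply_eq_zero hU hij)
    rw [h, Matrix.one_apply, Matrix.one_apply]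
    split_ifs <;> simp

theorem evalAt_generic : evalAt k (generic k n) = AlgHom.id k (Coord k n) := by
  refine MvPolynomial.algHom_ext fun q => ?_
  rw [evalAt, MvPolynomial.aeval_X, generic, Matrix.add_apply, Matrix.one_apply_ne q.2.ne,
    Matrix.of_apply, coordFn, dif_pos q.2, zero_add]
  rfl

theorem map_evalAt_generic (a : Matrix (Fin d) (Fin d) (Coord k n)) :
    a.map (evalAt k (generic k n)) = a := by
  rw [evalAt_generic]
  ext1 i j
  rfl

theorem counit_eq_evalAt : counit k n = evalAt k (1 : Matrix (Fin n) (Fin n) k) := by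
  refine MvPolynomial.algHom_ext fun q => ?_
  simp [evalAt, counit, Matrix.one_apply_ne q.2.ne]

/-- The comultiplication is matrix multiplication read at the universal pair of points, the two
copies of the generic matrix over `A ⊗ A`. -/
theorem comul_eq_evalAt : comul k n = evalAt k
    ((generic k n).map (Algebra.TensorProduct.includeLeft : Coord k n →ₐ[k] Coord k n ⊗[k] Coord k n)
      * (generic k n).map
        (Algebra.TensorProduct.includeRight : Coord k n →ₐ[k] Coord k n ⊗[k] Coord k n)) := by
  refine MvPolynomial.algHom_ext fun q => ?_
  set N : Matrix (Fin n) (Fin n) (Coord k n) := Matrix.of fun i j => coordFn k i j with hN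
  have hg : generic k n = 1 + N := rfl
  rw [comul, evalAt, MvPolynomial.aeval_X, MvPolynomial.aeval_X, hg]
  set l : Coord k n →ₐ[k] Coord k n ⊗[k] Coord k n := Algebra.TensorProduct.includeLeft
  set r : Coord k n →ₐ[k] Coord k n ⊗[k] Coord k n := Algebra.TensorProduct.includeRight
  have h : (1 + N).map l * (1 + N).map r = 1 + N.map r + N.map l * N.map r + N.map l := by
    change l.mapMatrix (1 + N) * r.mapMatrix (1 + N) = _
    rw [map_add, map_add, map_one, map_one]
    change (1 + N.map l) * (1 + N.map r) = _
    noncomm_ring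
  rw [h, Matrix.add_apply, Matrix.add_apply, Matrix.add_apply, Matrix.one_apply_ne q.2.ne, zero_add,
    Matrix.mul_apply]
  congr 1
  congr 1
  refine Finset.sum_subset_zero_on_sdiff (Finset.subset_univ _) (fun x hx => ?_) fun x _ => ?_
  · simp only [Finset.mem_sdiff, Finset.mem_univ, true_and, Finset.mem_Ioo, not_and_or] at hx
    rw [Matrix.map_apply, Matrix.map_apply, hN, Matrix.of_apply, Matrix.of_apply]
    rcases hx with hx | hx
    · rw [coordFn, dif_neg hx, map_zero, zero_mul]
    · rw [show coordFn k x q.1.2 = 0 from dif_neg hx, map_zero, mul_zero]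
  · simp [l, r, hN]

variable {V : Type v} [AddCommGroup V] [Module k V] (e : Module.Basis (Fin d) k V)

theorem ofMatrix_basis (a : Matrix (Fin d) (Fin d) (Coord k n)) (j : Fin d) :
    ofMatrix e a (e j) = ∑ i, e i ⊗ₜ[k] a i j := by
  rw [ofMatrix, Module.Basis.constr_basis]

theorem sum_tmul_injective {M : Type*} [AddCommGroup M] [Module k M] {x y : Fin d → M}
    (h : ∑ i, e i ⊗ₜ[k] x i = ∑ i, e i ⊗ₜ[k] y i) : x = y := by
  funext i
  have h1 := congrArg (fun t => (TensorProduct.equivFinsuppOfBasisLeft e t) i) h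
  simpa [Finsupp.single_apply, map_sum, Finsupp.finsetSum_apply,
    TensorProduct.equivFinsuppOfBasisLeft_apply_tmul_apply] using h1

theorem exists_eq_ofMatrix (ρ : V →ₗ[k] V ⊗[k] Coord k n) :
    ∃ a : Matrix (Fin d) (Fin d) (Coord k n), ρ = ofMatrix e a := by
  have h : ∀ t : V ⊗[k] Coord k n, ∃ x : Fin d → Coord k n, t = ∑ i, e i ⊗ₜ[k] x i := by
    intro t
    obtain ⟨b, rfl⟩ := TensorProduct.eq_repr_basis_left e t
    exact ⟨b, Finsupp.sum_fintype _ _ (by simp)⟩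
  choose x hx using fun j => h (ρ (e j))
  refine ⟨Matrix.of fun i j => x j i, e.ext fun j => ?_⟩
  rw [ofMatrix_basis, hx]
  rfl

/-- Coassociativity is multiplicativity at the universal pair of points over `A ⊗ A`; every pair of
points over `B` is a specialization of it. Likewise the counit axiom is the value at the identity
matrix. -/
theorem isRepresentation_ofMatrix_iff (a : Matrix (Fin d) (Fin d) (Coord k n)) :
    IsRepresentation (ofMatrix e a) ↔ IsPointwiseHom a := by
  set L : Coord k n →ₐ[k] Coord k n ⊗[k] Coord k n := Algebra.TensorProduct.includeLeft with hL
  set R : Coord k n →ₐ[k] Coord k n ⊗[k] Coord k n := Algebra.TensorProduct.includeRight with hR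
  have hleft : ∀ j, TensorProduct.assoc k V (Coord k n) (Coord k n)
      ((ofMatrix e a).rTensor (Coord k n) (ofMatrix e a (e j)))
        = ∑ i, e i ⊗ₜ[k] (a.map L * a.map R) i j := by
    intro j
    simp only [ofMatrix_basis, map_sum, LinearMap.rTensor_tmul, TensorProduct.sum_tmul,
      TensorProduct.assoc_tmul, Matrix.mul_apply, TensorProduct.tmul_sum]
    rw [Finset.sum_comm]
    refine Finset.sum_congr rfl fun i _ => Finset.sum_congr rfl fun l _ => ?_
    simp [hL, hR]
  have hright : ∀ j, (comul k n).toLinearMap.lTensor V (ofMatrix e a (e j))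
      = ∑ i, e i ⊗ₜ[k] (a.map (comul k n)) i j := by
    intro j
    simp [ofMatrix_basis]
  have hcounit : ∀ j, (counit k n).toLinearMap.lTensor V (ofMatrix e a (e j))
      = ∑ i, e i ⊗ₜ[k] (a.map (counit k n)) i j := by
    intro j
    simp [ofMatrix_basis]
  have hone : ∀ j, e j ⊗ₜ[k] (1 : k) = ∑ i, e i ⊗ₜ[k] (1 : Matrix (Fin d) (Fin d) k) i j := by
    intro j
    rw [Finset.sum_eq_single j]
    · simp
    · intro i _ hij
      rw [Matrix.one_apply_ne hij, TensorProduct.tmul_zero]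
    · simp
  constructor
  · intro h
    have hmul : a.map (comul k n) = a.map L * a.map R := by
      ext i j
      have := h.coassoc (e j)
      rw [hleft, hright] at this
      exact (congrFun (sum_tmul_injective e this) i).symm
    refine ⟨fun B _ _ U W hU hW => ?_, ?_⟩
    · let f : Coord k n ⊗[k] Coord k n →ₐ[k] B :=
        Algebra.TensorProduct.lift (evalAt k U) (evalAt k W) fun _ _ => Commute.all _ _
      have hfL : f.comp L = evalAt k U := AlgHom.ext fun x => by simp [f, L]
      have hfR : f.comp R = evalAt k W := AlgHom.ext fun x => by simp [f, R]
      have h1 := congrArg f.mapMatrix hmul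
      rw [map_mul, comul_eq_evalAt] at h1
      change (a.map (evalAt k _)).map f = (a.map L).map f * (a.map R).map f at h1
      rw [map_evalAt_map, Matrix.map_map, Matrix.map_map, ← AlgHom.coe_comp, ← AlgHom.coe_comp, hfL,
        hfR] at h1
      rw [← h1]
      congr 3
      rw [Matrix.map_mul, Matrix.map_map, Matrix.map_map, ← AlgHom.coe_comp, ← AlgHom.coe_comp, hfL,
        hfR, generic_map_evalAt hU, generic_map_evalAt hW]
    · rw [← counit_eq_evalAt]
      ext i j
      have := h.counit (e j)
      rw [hcounit, hone] at this
      exact congrFun (sum_tmul_injective e this) i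
  · intro h
    have hmul : a.map (comul k n) = a.map L * a.map R := by
      have h1 := h.mul _ ((generic k n).map L) ((generic k n).map R)
        (isUnip_generic.map L.toRingHom) (isUnip_generic.map R.toRingHom)
      rw [← map_evalAt_map, ← map_evalAt_map, map_evalAt_generic] at h1
      rw [comul_eq_evalAt]
      exact h1
    constructor
    · intro w
      refine LinearMap.congr_fun (f := (TensorProduct.assoc k V (Coord k n) (Coord k n)).toLinearMap
        ∘ₗ (ofMatrix e a).rTensor (Coord k n) ∘ₗ ofMatrix e a)
        (g := (comul k n).toLinearMap.lTensor V ∘ₗ ofMatrix e a) (e.ext fun j => ?_) w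
      change TensorProduct.assoc k V (Coord k n) (Coord k n)
        ((ofMatrix e a).rTensor (Coord k n) (ofMatrix e a (e j)))
          = (comul k n).toLinearMap.lTensor V (ofMatrix e a (e j))
      rw [hleft, hright, hmul]
    · intro w
      refine LinearMap.congr_fun (f := (counit k n).toLinearMap.lTensor V ∘ₗ ofMatrix e a)
        (g := (TensorProduct.mk k V k).flip 1) (e.ext fun j => ?_) w
      change (counit k n).toLinearMap.lTensor V (ofMatrix e a (e j)) = e j ⊗ₜ[k] (1 : k)
      rw [hcounit, hone, counit_eq_evalAt, h.one]

end Points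

/-! ### The representation attached to commuting nilpotent representations of `𝔲ₙ` -/

section Construction

variable {k : Type u} [Field k] {n d : ℕ}

/-- The values at the matrix units of a representation of `𝔲ₙ`, extended by zero. -/
noncomputable def values (φ : strictUpper k n →ₗ⁅k⁆ Matrix (Fin d) (Fin d) k) (i j : Fin n) :
    Matrix (Fin d) (Fin d) k :=
  if h : i < j then φ (unit k ⟨(i, j), h⟩) else 0

theorem values_of_pos (φ : strictUpper k n →ₗ⁅k⁆ Matrix (Fin d) (Fin d) k) (q : Pos n) :
    values φ q.1.1 q.1.2 = φ (unit k q) := dif_pos q.2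

theorem values_property {P : Matrix (Fin d) (Fin d) k → Prop}
    (φ : strictUpper k n →ₗ⁅k⁆ Matrix (Fin d) (Fin d) k) (h0 : P 0) (h : ∀ Y, P (φ Y))
    (i j : Fin n) : P (values φ i j) := by
  rw [values]
  split_ifs
  · exact h _
  · exact h0

theorem unitRelations_values (φ : strictUpper k n →ₗ⁅k⁆ Matrix (Fin d) (Fin d) k) :
    UnitRelations (values φ) := by
  refine ⟨fun i j hij => dif_neg (not_lt.mpr hij), fun i j hij l m hlm => ?_⟩
  have h1 : ∀ q r : Pos n, φ (unit k q) * φ (unit k r) - φ (unit k r) * φ (unit k q)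
      = φ ⁅unit k q, unit k r⁆ := fun q r => by
    rw [LieHom.map_lie, LieRing.of_associative_ring_bracket]
  rw [values, values, dif_pos hij, dif_pos hlm, h1]
  have h2 : ⁅unit k ⟨(i, j), hij⟩, unit k ⟨(l, m), hlm⟩⁆
      = (if h : j = l then unit k ⟨(i, m), by exact hij.trans (h ▸ hlm)⟩ else 0)
        - (if h : m = i then unit k ⟨(l, j), by exact hlm.trans (h ▸ hij)⟩ else 0) := by
    refine Subtype.ext ?_
    rw [LieSubalgebra.coe_bracket, LieRing.of_associative_ring_bracket]
    change Matrix.single i j 1 * Matrix.single l m 1 - Matrix.single l m 1 * Matrix.single i j 1 = _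
    rw [AddSubgroupClass.coe_sub]
    congr 1
    · split_ifs with h
      · subst h; rw [Matrix.single_mul_single_same, mul_one]; rfl
      · rw [Matrix.single_mul_single_of_ne _ _ _ _ h]; rfl
    · split_ifs with h
      · subst h; rw [Matrix.single_mul_single_same, mul_one]; rfl
      · rw [Matrix.single_mul_single_of_ne _ _ _ _ h]; rfl
  rw [h2, map_sub]
  congr 1
  · split_ifs with h
    · rw [values, dif_pos]
    · exact map_zero φ
  · split_ifs with h
    · rw [values, dif_pos]
    · exact map_zero φ

theorem extend_eq_extMat (φ : strictUpper k n →ₗ⁅k⁆ Matrix (Fin d) (Fin d) k)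
    (Y : Matrix (Fin n) (Fin n) (Coord k n)) : extend φ Y = extMat (Coord k n) (values φ) Y := by
  rw [extend, extMat_apply, ← Fintype.sum_prod_type'
    (f := fun i j => Y i j • (values φ i j).map (algebraMap k (Coord k n)))]
  refine Fintype.sum_of_injective Subtype.val Subtype.val_injective _ _ (fun q hq => ?_) fun q => ?_
  · have : values φ q.1 q.2 = 0 := dif_neg fun h => hq ⟨⟨q, h⟩, rfl⟩
    rw [this, Matrix.map_zero _ (map_zero _), smul_zero]
  · rw [values_of_pos]
    rfl

theorem nilExp_extend_map_evalAt (φ : strictUpper k n →ₗ⁅k⁆ Matrix (Fin d) (Fin d) k)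
    {B : Type*} [CommRing B] [Algebra k B] {U : Matrix (Fin n) (Fin n) B} (hU : IsUnip U) :
    (nilExp (extend φ (logGeneric k n))).map (evalAt k U) = groupExp B (values φ) U := by
  have h : nilExp (extend φ (logGeneric k n)) = groupExp (Coord k n) (values φ) (generic k n) := by
    rw [extend_eq_extMat]
    rfl
  rw [h, groupExp_map, generic_map_evalAt hU]

theorem exists_ringHom_pow {p : ℕ} [CharP k p] (hp : p.Prime) (B : Type*) [CommRing B]
    [Algebra k B] (l : ℕ) : ∃ F : B →+* B, ∀ x, F x = x ^ p ^ l := by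
  -- The zero ring does not have characteristic `p`, so it is treated apart.
  rcases subsingleton_or_nontrivial B with hB | hB
  · exact ⟨RingHom.id B, fun x => Subsingleton.elim _ _⟩
  · have : CharP B p := charP_of_injective_algebraMap (algebraMap k B).injective p
    have : Fact p.Prime := ⟨hp⟩
    exact ⟨iterateFrobenius B p l, fun x => iterateFrobenius_def p l x⟩

/-- The twist acts on the point rather than on the scalars of `M`. For `s = p ^ l` the entrywise
power comes from a ring homomorphism, so it respects products of points. -/
theorem powVars_map_evalAt (s : ℕ) (M : Matrix (Fin d) (Fin d) (Coord k n)) {B : Type*} [CommRing B]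
    [Algebra k B] (U : Matrix (Fin n) (Fin n) B) :
    (powVars s M).map (evalAt k U) = M.map (evalAt k (U.map (· ^ s))) := by
  have h : (evalAt k U).comp (MvPolynomial.expand s) = evalAt k (U.map (· ^ s)) := by
    refine MvPolynomial.algHom_ext fun q => ?_
    simp [evalAt]
  rw [powVars, Matrix.map_map, ← h]
  rfl

theorem bigPhi_map_evalAt {p : ℕ} [CharP k p] (hp : p.Prime) {m : ℕ}
    (φ : Fin (m + 1) → (strictUpper k n →ₗ⁅k⁆ Matrix (Fin d) (Fin d) k))
    {B : Type*} [CommRing B] [Algebra k B] {U : Matrix (Fin n) (Fin n) B} (hU : IsUnip U) :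
    (bigPhi p m φ).map (evalAt k U)
      = (List.ofFn fun l : Fin (m + 1) =>
          groupExp B (values (φ l)) (U.map (· ^ p ^ (l : ℕ)))).prod := by
  change (evalAt k U).mapMatrix _ = _
  rw [bigPhi, map_list_prod, List.map_ofFn]
  congr 2
  funext l
  obtain ⟨F, hF⟩ := exists_ringHom_pow (k := k) hp B (l : ℕ)
  have hU' : IsUnip (U.map (· ^ p ^ (l : ℕ))) := by
    rw [← funext hF]
    exact hU.map F
  rw [← nilExp_extend_map_evalAt (φ l) hU', ← powVars_map_evalAt]
  rfl

theorem prod_ofFn_mul {R : Type*} [Monoid R] {m : ℕ} (a b : Fin m → R)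
    (h : ∀ i j, i ≠ j → Commute (a i) (b j)) :
    (List.ofFn fun i => a i * b i).prod = (List.ofFn a).prod * (List.ofFn b).prod := by
  induction m with
  | zero => simp
  | succ m ih =>
    have hc : Commute (List.ofFn fun i : Fin m => a i.succ).prod (b 0) := by
      refine Commute.list_prod_left _ _ fun x hx => ?_
      obtain ⟨i, rfl⟩ := (List.mem_ofFn' _ _).mp hx
      exact h _ _ (Fin.succ_ne_zero i)
    rw [List.ofFn_succ, List.ofFn_succ, List.ofFn_succ, List.prod_cons, List.prod_cons,
      List.prod_cons, ih _ _ fun i j hij => h _ _ fun h' => hij (Fin.succ_injective _ h')]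
    simp only [mul_assoc]
    rw [← mul_assoc (b 0), ← hc.eq, mul_assoc]

theorem isPointwiseHom_bigPhi {p : ℕ} [CharP k p] (hp : p.Prime) (hn : n ≤ p) (hd : 2 * d ≤ p)
    {m : ℕ} {φ : Fin (m + 1) → (strictUpper k n →ₗ⁅k⁆ Matrix (Fin d) (Fin d) k)}
    (hφ : IsCommutingNilpotent φ) : IsPointwiseHom (bigPhi p m φ) := by
  refine ⟨fun B _ _ U V hU hV => ?_, ?_⟩
  · rw [bigPhi_map_evalAt hp φ (hU.mul hV), bigPhi_map_evalAt hp φ hU, bigPhi_map_evalAt hp φ hV,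
      ← prod_ofFn_mul]
    · congr 2
      funext l
      obtain ⟨F, hF⟩ := exists_ringHom_pow (k := k) hp B (l : ℕ)
      rw [← funext hF, Matrix.map_mul]
      exact groupExp_mul hp hn hd (unitRelations_values _)
        (values_property _ IsNilpotent.zero (hφ.nilpotent l)) (hU.map F) (hV.map F)
    · intro i j hij
      refine commute_groupExp (fun a b c e => ?_) _ _
      refine values_property (P := fun M => Commute M _) _ (Commute.zero_left _) (fun Y => ?_) a b
      exact values_property _ (Commute.zero_right _) (fun Z => hφ.commute i j hij Y Z) c e
  · rw [bigPhi_map_evalAt hp φ IsUnip.one]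
    refine List.prod_eq_one fun x hx => ?_
    obtain ⟨l, rfl⟩ := (List.mem_ofFn' _ _).mp hx
    obtain ⟨F, hF⟩ := exists_ringHom_pow (k := k) hp k (l : ℕ)
    beta_reduce
    rw [← funext hF, Matrix.map_one _ (map_zero F) (map_one F), groupExp_one]

end Construction

/-! ### One-parameter subgroups in characteristic `p` -/

section OneParam

variable {k : Type u} [Field k] {d : ℕ}

theorem pow_eq_zero_of_isNilpotent {M : Matrix (Fin d) (Fin d) k} (hM : IsNilpotent M) :
    M ^ d = 0 := by
  have h := (Matrix.isNilpotent_charpoly_sub_pow_of_isNilpotent hM).eq_zero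
  have h1 := Matrix.aeval_self_charpoly M
  rw [sub_eq_zero.mp h] at h1
  simpa using h1

/-- Lucas' congruence: multiplying by `p ^ i` only shifts base-`p` digits. -/
theorem cast_choose_pow_mul {p : ℕ} [CharP k p] (hp : p.Prime) (i a b : ℕ) :
    (((p ^ i * a).choose (p ^ i * b) : ℕ) : k) = (a.choose b : ℕ) := by
  have : Fact p.Prime := ⟨hp⟩
  induction i with
  | zero => simp
  | succ i ih =>
    rw [← ih, CharP.natCast_eq_natCast k p, pow_succ', mul_assoc, mul_assoc]
    refine Choose.choose_modEq_choose_mod_mul_choose_div_nat.trans ?_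
    rw [Nat.mul_mod_right, Nat.mul_mod_right, Nat.mul_div_cancel_left _ hp.pos,
      Nat.mul_div_cancel_left _ hp.pos, Nat.choose_self, one_mul]

theorem cast_choose_mod_self {p : ℕ} [CharP k p] (hp : p.Prime) (a : ℕ) :
    ((a.choose (a % p) : ℕ) : k) = 1 := by
  have : Fact p.Prime := ⟨hp⟩
  rw [← Nat.cast_one, CharP.natCast_eq_natCast k p]
  refine Choose.choose_modEq_choose_mod_mul_choose_div_nat.trans ?_
  rw [Nat.mod_mod, Nat.choose_self, Nat.div_eq_of_lt (Nat.mod_lt _ hp.pos), Nat.choose_zero_right]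

/-- The coefficients `c r` of a homomorphism `t ↦ ∑ t ^ r c r` from the additive group to `GL_d`. -/
structure IsOneParam (c : ℕ → Matrix (Fin d) (Fin d) k) : Prop where
  zero : c 0 = 1
  mul : ∀ a b, c a * c b = (((a + b).choose a : ℕ) : k) • c (a + b)

namespace IsOneParam

variable {p : ℕ} [CharP k p] {c c' c'' : ℕ → Matrix (Fin d) (Fin d) k}

theorem pow (hp : p.Prime) (hc : IsOneParam c) (i r : ℕ) :
    c (p ^ i) ^ r = (r.factorial : k) • c (p ^ i * r) := by
  induction r with
  | zero => simp [hc.zero]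
  | succ r ih =>
    have h : p ^ i * r + p ^ i = p ^ i * (r + 1) := by ring
    rw [pow_succ, ih, smul_mul_assoc, hc.mul, h, cast_choose_pow_mul hp, smul_smul,
      Nat.choose_succ_self_right, Nat.factorial_succ]
    push_cast
    rw [mul_comm]

theorem isNilpotent (hp : p.Prime) (hc : IsOneParam c) (i : ℕ) : IsNilpotent (c (p ^ i)) :=
  ⟨p, by
    rw [hc.pow hp, (CharP.cast_eq_zero_iff k p _).mpr (hp.dvd_factorial.mpr le_rfl), zero_smul]⟩

/-- By Lucas the relevant binomial coefficient is `1`, so `c (p ^ i * (a % p))` is a factor. It is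
`c (p ^ i) ^ (a % p)` up to an invertible factorial, and a nilpotent `d × d` matrix has zero `d`-th
power. -/
theorem eq_zero_of_le_mod (hp : p.Prime) (hc : IsOneParam c) (i : ℕ) {a : ℕ} (ha : d ≤ a % p) :
    c (p ^ i * a) = 0 := by
  have hlt := Nat.mod_lt a hp.pos
  have h1 : c (p ^ i * (a % p)) = 0 := by
    have h := hc.pow hp i (a % p)
    rw [pow_eq_zero_of_le ha (pow_eq_zero_of_isNilpotent (hc.isNilpotent hp i))] at h
    exact (smul_eq_zero.mp h.symm).resolve_left (factorial_ne_zero_of_lt hp hlt)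
  have h2 := hc.mul (p ^ i * (a % p)) (p ^ i * (a - a % p))
  rw [h1, zero_mul, ← mul_add, Nat.add_sub_cancel' (Nat.mod_le a p), cast_choose_pow_mul hp,
    cast_choose_mod_self hp, one_smul] at h2
  exact h2.symm

/-- Write `x = p ^ i * a` with `p ∤ a`. Then `y = p ^ i * b` and `p ∣ a + b`, so the last digits of
`a` and `b` add up to at least `p ≥ 2d`; one of them is at least `d`. -/
theorem eq_zero_or_eq_zero (hp : p.Prime) (hd : 2 * d ≤ p) (hc : IsOneParam c)
    (hc' : IsOneParam c') {x y l : ℕ} (hx : 0 < x) (hy : 0 < y) (hxy : x + y = p ^ l) :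
    c x = 0 ∨ c' y = 0 := by
  obtain ⟨i, a, ha, rfl⟩ := Nat.exists_eq_pow_mul_and_not_dvd hx.ne' p hp.ne_one
  have hpi : 0 < p ^ i := pow_pos hp.pos i
  have ha0 : 0 < a := Nat.pos_of_ne_zero fun h => ha (h ▸ dvd_zero p)
  have hil : i < l := by
    refine (Nat.pow_lt_pow_iff_right hp.one_lt).mp ?_
    have := Nat.le_mul_of_pos_right (p ^ i) ha0
    omega
  obtain ⟨s, rfl⟩ := Nat.exists_eq_add_of_lt hil
  have hdvd : p ^ i ∣ y := by
    refine (Nat.dvd_add_right (Dvd.intro a rfl)).mp ?_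
    rw [hxy]
    exact pow_dvd_pow p (by omega)
  obtain ⟨b, rfl⟩ := hdvd
  have hab : a + b = p * p ^ s := by
    refine Nat.eq_of_mul_eq_mul_left hpi ?_
    rw [mul_add, hxy]
    ring
  have h1 : 0 < a % p := Nat.pos_of_ne_zero fun h => ha (Nat.dvd_of_mod_eq_zero h)
  have h2 := Nat.mod_lt a hp.pos
  have h3 := Nat.mod_lt b hp.pos
  have h4 : p ∣ a % p + b % p := by
    rw [Nat.dvd_iff_mod_eq_zero, ← Nat.add_mod, hab, Nat.mul_mod_right]
  have h5 : p ≤ a % p + b % p := Nat.le_of_dvd (by omega) h4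
  rcases le_or_gt d (a % p) with h | h
  · exact Or.inl (hc.eq_zero_of_le_mod hp i h)
  · exact Or.inr (hc'.eq_zero_of_le_mod hp i (by omega))

/-- If some interior binomial coefficient of `a` is nonzero in `k`, then `c a` is determined by
smaller indices. Otherwise `p` divides all of them and `a` is a power of `p`. -/
theorem ext_of_pow (hp : p.Prime) (hc : IsOneParam c) (hc' : IsOneParam c')
    (h : ∀ i, c (p ^ i) = c' (p ^ i)) (a : ℕ) : c a = c' a := by
  have : Fact p.Prime := ⟨hp⟩
  induction a using Nat.strong_induction_on with
  | _ a ih =>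
    rcases Nat.eq_zero_or_pos a with rfl | ha
    · rw [hc.zero, hc'.zero]
    by_cases hb : ∃ b, 0 < b ∧ b < a ∧ ((a.choose b : ℕ) : k) ≠ 0
    · obtain ⟨b, hb0, hba, hne⟩ := hb
      have h1 := hc.mul b (a - b)
      have h2 := hc'.mul b (a - b)
      rw [ih b hba, ih (a - b) (by omega), h2, Nat.add_sub_cancel' hba.le] at h1
      exact (smul_right_injective _ hne h1).symm
    · push Not at hb
      have h1 := Choose.eq_pow_multiplicity_of_choose_modEq_zero_nat (p := p) ha (fun b hb0 => by
        rw [Finset.mem_Icc] at hb0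
        rw [← CharP.natCast_eq_natCast k p, Nat.cast_zero]
        exact hb b (by omega) (by omega))
      rw [h1]
      exact h _

/-- Comparison of the coefficients at `s ^ (p ^ l) t ^ (p ^ m)` in the commutator relation. -/
theorem sum_eq (hp : p.Prime) (hd : 2 * d ≤ p) (hc : IsOneParam c) (hc' : IsOneParam c')
    (hc'' : IsOneParam c'') {D l m : ℕ} (hl : p ^ l < D) (hm : p ^ m < D) :
    ∑ x ∈ Finset.range D, ∑ y ∈ Finset.range D, ∑ z ∈ Finset.range D,
        (if y + z = p ^ l ∧ x + y = p ^ m then (1 : k) else 0) • (c' x * c'' y * c z)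
      = c' (p ^ m) * c (p ^ l) + if l = m then c'' (p ^ l) else 0 := by
  have hl0 : 0 < p ^ l := pow_pos hp.pos l
  have hm0 : 0 < p ^ m := pow_pos hp.pos m
  -- A solution either has `y = 0`, or has `x = z = 0` and then `l = m`, or splits `p ^ l` or `p ^
  -- m` into two positive parts; in the last case `eq_zero_or_eq_zero` applies.
  have hterm : ∀ x y z : ℕ,
      (if y + z = p ^ l ∧ x + y = p ^ m then (1 : k) else 0) • (c' x * c'' y * c z)
        = (if (x, y, z) = (p ^ m, 0, p ^ l) then c' (p ^ m) * c (p ^ l) else 0)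
          + (if (x, y, z) = (0, p ^ l, 0) then (if l = m then c'' (p ^ l) else 0) else 0) := by
    intro x y z
    simp only [Prod.mk.injEq]
    by_cases h : y + z = p ^ l ∧ x + y = p ^ m
    swap
    · rw [if_neg h, zero_smul, if_neg (by rintro ⟨rfl, rfl, rfl⟩; simp at h), zero_add]
      split_ifs with h1 h2
      · obtain ⟨rfl, rfl, rfl⟩ := h1
        subst h2
        simp at h
      · rfl
      · rfl
    obtain ⟨h1, h2⟩ := h
    rw [if_pos ⟨h1, h2⟩, one_smul]
    rcases Nat.eq_zero_or_pos y with rfl | hy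
    · rw [if_pos (by omega), if_neg (by omega), add_zero, hc''.zero, mul_one,
        show x = p ^ m by omega, show z = p ^ l by omega]
    rw [if_neg (by omega), zero_add]
    rcases Nat.eq_zero_or_pos z with rfl | hz
    · rcases Nat.eq_zero_or_pos x with rfl | hx
      · have hlm : l = m := Nat.pow_right_injective hp.two_le (by simp only; omega)
        rw [if_pos (by omega), if_pos hlm, hc'.zero, hc.zero, one_mul, mul_one,
          show y = p ^ l by omega]
      · rw [if_neg (by omega)]
        rcases hc'.eq_zero_or_eq_zero hp hd hc'' hx hy h2 with h | h
        · rw [h, zero_mul, zero_mul]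
        · rw [h, mul_zero, zero_mul]
    · rw [if_neg (by omega)]
      rcases hc''.eq_zero_or_eq_zero hp hd hc hy hz h1 with h | h
      · rw [h, mul_zero, zero_mul]
      · rw [h, mul_zero]
  simp only [hterm]
  simp only [← Finset.sum_product', Prod.mk.eta]
  rw [Finset.sum_add_distrib, Finset.sum_ite_eq', Finset.sum_ite_eq', if_pos, if_pos]
  · simp only [Finset.mem_product, Finset.mem_range]; omega
  · simp only [Finset.mem_product, Finset.mem_range]; omega

end IsOneParam

/-! ### Comparison of coefficients -/

/-- `∑_{r < D} b ^ r c r`. -/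
noncomputable def series {B : Type*} [CommRing B] [Algebra k B] (D : ℕ)
    (c : ℕ → Matrix (Fin d) (Fin d) k) (b : B) : Matrix (Fin d) (Fin d) B :=
  ∑ r ∈ Finset.range D, b ^ r • (c r).map (algebraMap k B)

open Polynomial

/-- The coefficient at `s ^ l t ^ m` of a polynomial in `s` and `t`. -/
noncomputable def coeff₂ (k : Type u) [Field k] (l m : ℕ) : k[X][X] →ₗ[k] k :=
  lcoeff k l ∘ₗ (lcoeff k[X] m).restrictScalars k

theorem coeff₂_apply (l m : ℕ) (P : k[X][X]) : coeff₂ k l m P = (P.coeff m).coeff l := rfl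

theorem coeff₂_mapMatrix_smul (l m : ℕ) (P : k[X][X]) (M : Matrix (Fin d) (Fin d) k) :
    (coeff₂ k l m).mapMatrix (P • M.map (algebraMap k k[X][X])) = coeff₂ k l m P • M := by
  ext i j
  simp only [LinearMap.mapMatrix_apply, Matrix.map_apply, Matrix.smul_apply, smul_eq_mul]
  rw [← Algebra.commutes, ← Algebra.smul_def, map_smul, smul_eq_mul, mul_comm]

theorem coeff₂_monomial (l m a b : ℕ) :
    coeff₂ k l m ((C X) ^ a * X ^ b) = if a = l ∧ b = m then 1 else 0 := by
  rw [coeff₂_apply, ← C_pow, coeff_C_mul_X_pow]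
  by_cases hb : m = b
  · rw [if_pos hb, coeff_X_pow]
    simp [hb, eq_comm]
  · rw [if_neg hb, if_neg (by tauto), coeff_zero]

theorem coeff₂_add_pow (l m r : ℕ) :
    coeff₂ k l m ((C X + X) ^ r) = if r = l + m then ((l + m).choose l : k) else 0 := by
  rw [coeff₂_apply, add_comm, coeff_X_add_C_pow, ← C_eq_natCast, coeff_mul_C, coeff_X_pow]
  by_cases h : r = l + m
  · subst h
    rw [if_pos (by omega), if_pos rfl, one_mul, Nat.choose_symm_add]
  · rw [if_neg h]
    by_cases hm : m ≤ r
    · rw [if_neg (by omega), zero_mul]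
    · rw [Nat.choose_eq_zero_of_lt (by omega), Nat.cast_zero, mul_zero]

theorem series_mul_series {B : Type*} [CommRing B] [Algebra k B] (D : ℕ)
    (c c' : ℕ → Matrix (Fin d) (Fin d) k) (b b' : B) :
    series D c b * series D c' b' = ∑ x ∈ Finset.range D, ∑ y ∈ Finset.range D,
      (b ^ x * b' ^ y) • (c x * c' y).map (algebraMap k B) := by
  rw [series, series, Finset.sum_mul_sum]
  simp only [smul_mul_smul_comm, Matrix.map_mul]

variable {D : ℕ} {c c' c'' : ℕ → Matrix (Fin d) (Fin d) k}

theorem coeff₂_series_mul_series {l m : ℕ} (hl : l < D) (hm : m < D) :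
    (coeff₂ k l m).mapMatrix (series D c (C X : k[X][X]) * series D c' (X : k[X][X]))
      = c l * c' m := by
  rw [series_mul_series]
  simp only [map_sum, coeff₂_mapMatrix_smul, coeff₂_monomial]
  rw [Finset.sum_eq_single l, Finset.sum_eq_single m]
  · simp
  · intro y _ hy
    rw [if_neg (by tauto), zero_smul]
  · simp [hm]
  · intro x _ hx
    refine Finset.sum_eq_zero fun y _ => ?_
    rw [if_neg (by tauto), zero_smul]
  · simp [hl]

/-- The truncation `D` must be allowed to be arbitrarily large, so that the coefficient at `s ^ l t
^ m` is not cut off. -/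
theorem isOneParam_of_series (h0 : c 0 = 1)
    (h : ∀ D₀, ∃ D, D₀ < D ∧ series D c (C X + X : k[X][X])
      = series D c (C X : k[X][X]) * series D c (X : k[X][X])) : IsOneParam c := by
  refine ⟨h0, fun l m => ?_⟩
  obtain ⟨D, hD, hs⟩ := h (l + m)
  rw [← coeff₂_series_mul_series (D := D) (by omega) (by omega), ← hs, series]
  simp only [map_sum, coeff₂_mapMatrix_smul, coeff₂_add_pow]
  rw [Finset.sum_eq_single (l + m)]
  · rw [if_pos rfl]
  · intro r _ hr
    rw [if_neg hr, zero_smul]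
  · simp [hD]

theorem commute_of_series (h : ∀ D₀, ∃ D, D₀ < D ∧
      series D c (C X : k[X][X]) * series D c' (X : k[X][X])
        = series D c' (X : k[X][X]) * series D c (C X : k[X][X])) (l m : ℕ) :
    Commute (c l) (c' m) := by
  obtain ⟨D, hD, hs⟩ := h (l + m)
  rw [Commute, SemiconjBy, ← coeff₂_series_mul_series (D := D) (by omega) (by omega), hs,
    series_mul_series]
  simp only [map_sum, coeff₂_mapMatrix_smul, mul_comm (X ^ _ : k[X][X]), coeff₂_monomial]
  rw [Finset.sum_eq_single m, Finset.sum_eq_single l]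
  · simp
  · intro y _ hy
    rw [if_neg (by tauto), zero_smul]
  · intro h'; exact absurd (Finset.mem_range.mpr (by omega)) h'
  · intro x _ hx
    refine Finset.sum_eq_zero fun y _ => ?_
    rw [if_neg (by tauto), zero_smul]
  · intro h'; exact absurd (Finset.mem_range.mpr (by omega)) h'

/-- The hypothesis is the relation `u_ij(s) u_jm(t) = u_jm(t) u_im(st) u_ij(s)`, with the factors
ordered so that no inverses occur. -/
theorem bracket_of_series {p : ℕ} [CharP k p] (hp : p.Prime) (hd : 2 * d ≤ p) (hc : IsOneParam c)
    (hc' : IsOneParam c') (hc'' : IsOneParam c'')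
    (h : ∀ D₀, ∃ D, D₀ < D ∧ series D c (C X : k[X][X]) * series D c' (X : k[X][X])
        = series D c' (X : k[X][X]) * series D c'' (C X * X : k[X][X])
          * series D c (C X : k[X][X])) (l m : ℕ) :
    c (p ^ l) * c' (p ^ m)
      = c' (p ^ m) * c (p ^ l) + if l = m then c'' (p ^ l) else 0 := by
  obtain ⟨D, hD, hs⟩ := h (p ^ l + p ^ m)
  rw [← coeff₂_series_mul_series (D := D) (by omega) (by omega), hs, series_mul_series,
    ← IsOneParam.sum_eq hp hd hc hc' hc'' (D := D) (by omega) (by omega), series]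
  simp only [Finset.sum_mul, Finset.mul_sum, smul_mul_smul_comm, ← Matrix.map_mul, map_sum]
  rw [Finset.sum_comm' (t' := Finset.range D) (s' := fun _ => Finset.range D) (by simp)]
  refine Finset.sum_congr rfl fun x _ => ?_
  rw [Finset.sum_comm]
  refine Finset.sum_congr rfl fun y _ => Finset.sum_congr rfl fun z _ => ?_
  rw [coeff₂_mapMatrix_smul]
  have hmon : (X ^ x * (C X * X) ^ y * (C X) ^ z : k[X][X]) = (C X) ^ (y + z) * X ^ (x + y) := by
    ring
  rw [hmon, coeff₂_monomial]

end OneParam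

section Classification

variable {k : Type u} [Field k] {n d : ℕ}

open Polynomial

/-! ### Coefficients of a product of exponentials -/

theorem coeff_mul_matrix (P Q : Matrix (Fin d) (Fin d) k[X]) (r : ℕ) :
    (P * Q).map (fun f => f.coeff r) = ∑ x ∈ Finset.HasAntidiagonal.antidiagonal r,
      P.map (fun f => f.coeff x.1) * Q.map (fun f => f.coeff x.2) := by
  ext i j
  simp only [Matrix.map_apply, Matrix.mul_apply, finsetSum_coeff, coeff_mul, Matrix.sum_apply]
  rw [Finset.sum_comm]

theorem DegreeLE.coeff_eq_zero {P : Matrix (Fin d) (Fin d) k[X]} {r s : ℕ} (hP : DegreeLE r P)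
    (hs : r < s) : P.map (fun f => f.coeff s) = 0 := by
  ext i j
  exact coeff_eq_zero_of_natDegree_lt ((hP i j).trans_lt hs)

/-- The matrix `exp (t ^ s x)`. -/
noncomputable def expFactor (s : ℕ) (x : Matrix (Fin d) (Fin d) k) : Matrix (Fin d) (Fin d) k[X] :=
  truncExp k d ((X ^ s : k[X]) • x.map (algebraMap k k[X]))

theorem expFactor_eq (s : ℕ) (x : Matrix (Fin d) (Fin d) k) : expFactor s x
    = ∑ r ∈ Finset.range d, (X ^ (s * r) : k[X]) •
        (((r.factorial : k)⁻¹) • x ^ r).map (algebraMap k k[X]) := by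
  rw [expFactor, truncExp]
  refine Finset.sum_congr rfl fun r _ => ?_
  change _ = (X ^ (s * r) : k[X]) • (Algebra.ofId k k[X]).mapMatrix (((r.factorial : k)⁻¹) • x ^ r)
  rw [_root_.smul_pow, ← pow_mul, map_smul, map_pow, smul_comm]
  rfl

theorem expFactor_coeff (s : ℕ) (x : Matrix (Fin d) (Fin d) k) (l : ℕ) :
    (expFactor s x).map (fun f => f.coeff l)
      = ∑ r ∈ Finset.range d, if l = s * r then ((r.factorial : k)⁻¹) • x ^ r else 0 := by
  rw [expFactor_eq]
  ext i j
  simp only [Matrix.map_apply, Matrix.sum_apply, finsetSum_coeff]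
  refine Finset.sum_congr rfl fun r _ => ?_
  rw [Matrix.smul_apply, Matrix.map_apply, smul_eq_mul, Polynomial.algebraMap_apply, coeff_mul_C,
    coeff_X_pow]
  split_ifs <;> simp

theorem degreeLE_expFactor (s : ℕ) (x : Matrix (Fin d) (Fin d) k) :
    DegreeLE (s * (d - 1)) (expFactor s x) := by
  rw [expFactor_eq]
  refine DegreeLE.sum fun r hr i j => ?_
  rw [Matrix.smul_apply, Matrix.map_apply, smul_eq_mul, Polynomial.algebraMap_apply]
  refine (natDegree_mul_C_le _ _).trans ((natDegree_X_pow_le _).trans ?_)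
  rw [Finset.mem_range] at hr
  exact Nat.mul_le_mul_left s (by omega)

/-- The factor at `l` contributes exponents `p ^ l * r` with `r < d ≤ p`, so the exponents behave
like base-`p` digits: `p ^ i` is reached only through the linear term of the factor at `i`. The
degree bound is carried along for the induction. -/
theorem prod_expFactor_coeff {p : ℕ} (hp : p.Prime) (hd : d ≤ p) (hd0 : 0 < d)
    (x : ℕ → Matrix (Fin d) (Fin d) k) (hx : ∀ l, IsNilpotent (x l)) (m : ℕ) :
    DegreeLE (p ^ m - 1) (List.ofFn fun l : Fin m => expFactor (p ^ (l : ℕ)) (x l)).prod ∧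
    (List.ofFn fun l : Fin m => expFactor (p ^ (l : ℕ)) (x l)).prod.map (fun f => f.coeff 0) = 1 ∧
    ∀ i, (List.ofFn fun l : Fin m => expFactor (p ^ (l : ℕ)) (x l)).prod.map
      (fun f => f.coeff (p ^ i)) = if i < m then x i else 0 := by
  induction m with
  | zero =>
    refine ⟨fun i j => ?_, ?_, fun i => ?_⟩
    · rw [List.ofFn_zero, List.prod_nil, Matrix.one_apply]
      split_ifs <;> simp
    · ext i j
      rw [List.ofFn_zero, List.prod_nil, Matrix.map_apply, Matrix.one_apply, Matrix.one_apply]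
      split_ifs <;> simp
    · ext a b
      have : p ^ i ≠ 0 := (pow_pos hp.pos i).ne'
      rw [List.ofFn_zero, List.prod_nil, Matrix.map_apply, Matrix.one_apply]
      split_ifs <;> simp_all [coeff_one]
  | succ m ih =>
    rw [List.ofFn_succ', List.concat_eq_append, List.prod_append, List.prod_singleton]
    simp only [Fin.val_castSucc, Fin.val_last]
    obtain ⟨hdeg, h0, hpow⟩ := ih
    set P := (List.ofFn fun l : Fin m => expFactor (p ^ (l : ℕ)) (x l)).prod with hP
    set E := expFactor (p ^ m) (x m) with hE
    have hpm : 0 < p ^ m := pow_pos hp.pos m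
    have hE0 : E.map (fun f => f.coeff 0) = 1 := by
      rw [hE, expFactor_coeff, Finset.sum_eq_single 0]
      · simp
      · intro r _ hr
        rw [if_neg (by rw [eq_comm, Nat.mul_eq_zero]; omega)]
      · simp; omega
    have hE1 : E.map (fun f => f.coeff (p ^ m)) = x m := by
      have hiff : ∀ r, p ^ m = p ^ m * r ↔ r = 1 := fun r => by
        rw [eq_comm, Nat.mul_eq_left hpm.ne']
      rw [hE, expFactor_coeff]
      simp only [hiff]
      rw [Finset.sum_ite_eq']
      split_ifs with h
      · simp
      -- The truncated exponential has no linear term when `d = 1`, but then a nilpotent matrix is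
      -- zero.
      · have hd1 : d = 1 := by rw [Finset.mem_range] at h; omega
        have h1 := pow_eq_zero_of_isNilpotent (hx m)
        rw [← pow_one (x m)]
        conv_rhs => rw [show 1 = d from hd1.symm]
        exact h1.symm
    have hE2 : ∀ b, 0 < b → b < p ^ m → E.map (fun f => f.coeff b) = 0 := by
      intro b hb hbm
      rw [hE, expFactor_coeff]
      refine Finset.sum_eq_zero fun r _ => if_neg ?_
      rintro rfl
      exact absurd (Nat.le_of_dvd hb (Dvd.intro r rfl)) (by omega)
    have hdeg' : DegreeLE (p ^ (m + 1) - 1) (P * E) := by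
      refine (hdeg.mul (degreeLE_expFactor _ _)).mono ?_
      obtain ⟨d', rfl⟩ := Nat.exists_eq_succ_of_ne_zero hd0.ne'
      have h1 : p ^ m * (d' + 1) ≤ p ^ m * p := Nat.mul_le_mul_left _ hd
      rw [pow_succ]
      simp only [Nat.succ_eq_add_one, Nat.add_sub_cancel]
      rw [mul_add, mul_one] at h1
      omega
    refine ⟨hdeg', ?_, fun i => ?_⟩
    · rw [coeff_mul_matrix, Finset.Nat.antidiagonal_zero, Finset.sum_singleton, h0, hE0, one_mul]
    · rcases lt_trichotomy i m with hi | hi | hi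
      · have hlt : p ^ i < p ^ m := Nat.pow_lt_pow_right hp.one_lt hi
        rw [coeff_mul_matrix, Finset.sum_eq_single (p ^ i, 0), hE0, mul_one, hpow, if_pos hi,
          if_pos (by omega)]
        · rintro ⟨a, b⟩ hab hne
          rw [Finset.HasAntidiagonal.mem_antidiagonal] at hab
          simp only at hab
          rw [hE2 b, mul_zero]
          · refine Nat.pos_of_ne_zero fun hb => hne ?_
            subst hb
            simpa using hab
          · omega
        · simp
      · subst hi
        rw [coeff_mul_matrix, Finset.sum_eq_single (0, p ^ i), hE1, h0, one_mul, if_pos (by omega)]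
        · rintro ⟨a, b⟩ hab hne
          rw [Finset.HasAntidiagonal.mem_antidiagonal] at hab
          simp only at hab ⊢
          rcases Nat.eq_zero_or_pos b with rfl | hb
          · rw [show a = p ^ i by omega, hpow, if_neg (lt_irrefl i), zero_mul]
          · rw [hE2 b hb, mul_zero]
            refine lt_of_le_of_ne (by omega) fun hb' => hne ?_
            rw [Prod.mk.injEq]
            omega
        · simp
      · rw [if_neg (by omega)]
        refine hdeg'.coeff_eq_zero ?_
        have := Nat.pow_le_pow_right hp.pos (show m + 1 ≤ i from hi)
        have := pow_pos hp.pos (m + 1)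
        omega

/-! ### Restriction to elementary one-parameter subgroups -/

/-- The restriction of `a` to the one-parameter subgroup `t ↦ 1 + t ε_q`. -/
noncomputable def restrict (a : Matrix (Fin d) (Fin d) (Coord k n)) (q : Pos n) :
    Matrix (Fin d) (Fin d) k[X] :=
  a.map (evalAt k (1 + Matrix.single q.1.1 q.1.2 (X : k[X])))

/-- The coefficient at `t ^ r` of the restriction of `a` to `t ↦ 1 + t ε_q`. -/
noncomputable def coeffs (a : Matrix (Fin d) (Fin d) (Coord k n)) (q : Pos n) (r : ℕ) :
    Matrix (Fin d) (Fin d) k :=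
  (restrict a q).map fun f => f.coeff r

theorem restrict_map_aeval (a : Matrix (Fin d) (Fin d) (Coord k n)) (q : Pos n) {B : Type*}
    [CommRing B] [Algebra k B] (b : B) :
    (restrict a q).map (aeval b) = a.map (evalAt k (1 + Matrix.single q.1.1 q.1.2 b)) := by
  have h : (1 + Matrix.single q.1.1 q.1.2 (X : k[X])).map (aeval (R := k) b)
      = 1 + Matrix.single q.1.1 q.1.2 b := by
    rw [Matrix.map_add _ (map_add _), Matrix.map_one _ (map_zero _) (map_one _),
      Matrix.map_single _ _ _ (aeval (R := k) b), aeval_X]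
  rw [restrict, map_evalAt_map, h]

theorem exists_degree_bound (a : Matrix (Fin d) (Fin d) (Coord k n)) :
    ∃ D₀, ∀ q, DegreeLE D₀ (restrict a q) := by
  obtain ⟨D₀, h⟩ := Finite.exists_le
    fun x : Pos n × Fin d × Fin d => (restrict a x.1 x.2.1 x.2.2).natDegree
  exact ⟨D₀, fun q i j => h (q, i, j)⟩

theorem map_evalAt_elementary {a : Matrix (Fin d) (Fin d) (Coord k n)} {q : Pos n} {D₀ D : ℕ}
    (hD₀ : DegreeLE D₀ (restrict a q)) (hD : D₀ < D) {B : Type*} [CommRing B] [Algebra k B]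
    (b : B) :
    a.map (evalAt k (1 + Matrix.single q.1.1 q.1.2 b)) = series D (coeffs a q) b := by
  rw [← restrict_map_aeval, series]
  ext i j
  rw [Matrix.map_apply, aeval_eq_sum_range' ((hD₀ i j).trans_lt hD), Matrix.sum_apply]
  refine Finset.sum_congr rfl fun r _ => ?_
  rw [Matrix.smul_apply, Matrix.map_apply, smul_eq_mul, Algebra.smul_def, mul_comm]
  rfl

/-! ### Commutation relations between elementary matrices -/

section Elementary

variable {B : Type*} [CommRing B]

theorem elementary_mul_self (q : Pos n) (b b' : B) :
    (1 + Matrix.single q.1.1 q.1.2 b) * (1 + Matrix.single q.1.1 q.1.2 b')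
      = 1 + Matrix.single q.1.1 q.1.2 (b + b') := by
  have h : Matrix.single q.1.1 q.1.2 b * Matrix.single q.1.1 q.1.2 b' = 0 :=
    Matrix.single_mul_single_of_ne _ _ _ _ q.2.ne' _
  rw [add_mul, one_mul, mul_add, mul_one, h, Matrix.single_add]
  abel

theorem elementary_mul_comm {q r : Pos n} (h1 : q.1.2 ≠ r.1.1) (h2 : r.1.2 ≠ q.1.1) (b b' : B) :
    (1 + Matrix.single q.1.1 q.1.2 b) * (1 + Matrix.single r.1.1 r.1.2 b')
      = (1 + Matrix.single r.1.1 r.1.2 b') * (1 + Matrix.single q.1.1 q.1.2 b) := by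
  have h3 : Matrix.single q.1.1 q.1.2 b * Matrix.single r.1.1 r.1.2 b' = 0 :=
    Matrix.single_mul_single_of_ne _ _ _ _ h1 _
  have h4 : Matrix.single r.1.1 r.1.2 b' * Matrix.single q.1.1 q.1.2 b = 0 :=
    Matrix.single_mul_single_of_ne _ _ _ _ h2 _
  rw [add_mul, one_mul, mul_add, mul_one, h3, add_mul, one_mul, mul_add, mul_one, h4]
  abel

theorem elementary_mul_elementary {i j m : Fin n} (hij : i < j) (hjm : j < m) (b b' : B) :
    (1 + Matrix.single i j b) * (1 + Matrix.single j m b')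
      = (1 + Matrix.single j m b') * (1 + Matrix.single i m (b * b')) * (1 + Matrix.single i j b) := by
  have h1 : Matrix.single i j b * Matrix.single j m b' = Matrix.single i m (b * b') :=
    Matrix.single_mul_single_same _ _ _ _ _
  have h2 : Matrix.single j m b' * Matrix.single i m (b * b') = 0 :=
    Matrix.single_mul_single_of_ne _ _ _ _ (hij.trans hjm).ne' _
  have h3 : Matrix.single j m b' * Matrix.single i j b = 0 :=
    Matrix.single_mul_single_of_ne _ _ _ _ (hij.trans hjm).ne' _
  have h4 : Matrix.single i m (b * b') * Matrix.single i j b = 0 :=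
    Matrix.single_mul_single_of_ne _ _ _ _ (hij.trans hjm).ne' _
  simp only [add_mul, mul_add, one_mul, mul_one, h1, h2, h3, h4, zero_mul]
  abel

end Elementary

namespace IsPointwiseHom

variable {a : Matrix (Fin d) (Fin d) (Coord k n)}

theorem map_evalAt_one (ha : IsPointwiseHom a) (B : Type*) [CommRing B] [Algebra k B] :
    a.map (evalAt k (1 : Matrix (Fin n) (Fin n) B)) = 1 := by
  have h := map_evalAt_map (Algebra.ofId k B) (1 : Matrix (Fin n) (Fin n) k) a
  rw [ha.one, Matrix.map_one _ (map_zero _) (map_one _),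
    Matrix.map_one _ (map_zero _) (map_one _)] at h
  exact h.symm

theorem isOneParam (ha : IsPointwiseHom a) (q : Pos n) : IsOneParam (coeffs a q) := by
  obtain ⟨D₀, hD₀⟩ := exists_degree_bound a
  refine isOneParam_of_series ?_ fun D₁ => ⟨D₀ + D₁ + 1, by omega, ?_⟩
  · have h := restrict_map_aeval a q (0 : k)
    rw [Matrix.single_zero, add_zero, ha.one] at h
    rw [← h]
    ext i j
    simp [coeffs, coeff_zero_eq_aeval_zero]
  · have hD : D₀ < D₀ + D₁ + 1 := by omega
    rw [← map_evalAt_elementary (hD₀ q) hD (C X + X : k[X][X]),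
      ← map_evalAt_elementary (hD₀ q) hD (C X : k[X][X]),
      ← map_evalAt_elementary (hD₀ q) hD (X : k[X][X]), ← elementary_mul_self]
    exact ha.mul _ _ _ (IsUnip.elementary q _) (IsUnip.elementary q _)

theorem commute_coeffs (ha : IsPointwiseHom a) {q r : Pos n} (h1 : q.1.2 ≠ r.1.1)
    (h2 : r.1.2 ≠ q.1.1) (l m : ℕ) : Commute (coeffs a q l) (coeffs a r m) := by
  obtain ⟨D₀, hD₀⟩ := exists_degree_bound a
  refine commute_of_series (fun D₁ => ⟨D₀ + D₁ + 1, by omega, ?_⟩) l m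
  have hD : D₀ < D₀ + D₁ + 1 := by omega
  rw [← map_evalAt_elementary (hD₀ q) hD (C X : k[X][X]),
    ← map_evalAt_elementary (hD₀ r) hD (X : k[X][X])]
  have h3 := ha.mul _ _ _ (IsUnip.elementary q (C X : k[X][X])) (IsUnip.elementary r (X : k[X][X]))
  have h4 := ha.mul _ _ _ (IsUnip.elementary r (X : k[X][X])) (IsUnip.elementary q (C X : k[X][X]))
  rw [← h3, ← h4, elementary_mul_comm h1 h2]

theorem bracket_coeffs {p : ℕ} [CharP k p] (hp : p.Prime) (hd : 2 * d ≤ p)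
    (ha : IsPointwiseHom a) {i j m : Fin n} (hij : i < j) (hjm : j < m) (l l' : ℕ) :
    coeffs a ⟨(i, j), hij⟩ (p ^ l) * coeffs a ⟨(j, m), hjm⟩ (p ^ l')
      = coeffs a ⟨(j, m), hjm⟩ (p ^ l') * coeffs a ⟨(i, j), hij⟩ (p ^ l)
        + if l = l' then coeffs a ⟨(i, m), hij.trans hjm⟩ (p ^ l) else 0 := by
  obtain ⟨D₀, hD₀⟩ := exists_degree_bound a
  refine bracket_of_series hp hd (ha.isOneParam _) (ha.isOneParam _) (ha.isOneParam _)
    (fun D₁ => ⟨D₀ + D₁ + 1, by omega, ?_⟩) l l'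
  have hD : D₀ < D₀ + D₁ + 1 := by omega
  have hu := IsUnip.elementary (B := k[X][X]) (n := n)
  rw [← map_evalAt_elementary (hD₀ ⟨(i, j), hij⟩) hD (C X : k[X][X]),
    ← map_evalAt_elementary (hD₀ ⟨(j, m), hjm⟩) hD (X : k[X][X]),
    ← map_evalAt_elementary (hD₀ ⟨(i, m), hij.trans hjm⟩) hD (C X * X : k[X][X])]
  have h1 := ha.mul _ _ _ (hu ⟨(i, j), hij⟩ (C X)) (hu ⟨(j, m), hjm⟩ X)
  have h2 := ha.mul _ _ _ (hu ⟨(j, m), hjm⟩ X) (hu ⟨(i, m), hij.trans hjm⟩ (C X * X))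
  have h3 := ha.mul _ _ _ ((hu ⟨(j, m), hjm⟩ X).mul (hu ⟨(i, m), hij.trans hjm⟩ (C X * X)))
    (hu ⟨(i, j), hij⟩ (C X))
  rw [← h1, ← h2, ← h3, elementary_mul_elementary hij hjm]

/-- The coefficients fix the values at elementary matrices over every algebra; the generic matrix is
a product of such over `A_n`, and evaluating there returns the matrix itself. -/
theorem ext (ha : IsPointwiseHom a) {b : Matrix (Fin d) (Fin d) (Coord k n)}
    (hb : IsPointwiseHom b) (h : ∀ q r, coeffs a q r = coeffs b q r) : a = b := by
  have hres : ∀ q, restrict a q = restrict b q := fun q => by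
    ext i j r
    exact congrFun (congrFun (h q r) i) j
  have key := IsUnip.induction
    (P := fun U : Matrix (Fin n) (Fin n) (Coord k n) => IsUnip U →
      a.map (evalAt k U) = b.map (evalAt k U))
    (fun _ => by rw [ha.map_evalAt_one, hb.map_evalAt_one])
    (fun U hU ih q x _ => by
      rw [ha.mul _ _ _ hU (IsUnip.elementary q x), hb.mul _ _ _ hU (IsUnip.elementary q x), ih hU,
        ← restrict_map_aeval, ← restrict_map_aeval, hres])
    (isUnip_generic (k := k) (n := n)) isUnip_generic
  rwa [map_evalAt_generic, map_evalAt_generic] at key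

end IsPointwiseHom

/-! ### The classification -/

/-- The representation of `𝔲ₙ` with prescribed values at the matrix units. -/
noncomputable def lieHomOfRelations {X : Fin n → Fin n → Matrix (Fin d) (Fin d) k}
    (hX : UnitRelations X) : strictUpper k n →ₗ⁅k⁆ Matrix (Fin d) (Fin d) k where
  toLinearMap := extMat k X ∘ₗ (strictUpper k n).toSubmodule.subtype
  map_lie' := by
    intro M N
    have hs : ∀ M : strictUpper k n, HeightGE 1 M.1 := fun M i j hij =>
      M.2 i j (by rw [Fin.le_def]; omega)
    change extMat k X (⁅M, N⁆ : strictUpper k n).1 = ⁅extMat k X M.1, extMat k X N.1⁆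
    rw [LieSubalgebra.coe_bracket, LieRing.of_associative_ring_bracket,
      LieRing.of_associative_ring_bracket]
    exact extMat_bracket hX (hs M) (hs N)

theorem lieHomOfRelations_apply {X : Fin n → Fin n → Matrix (Fin d) (Fin d) k}
    (hX : UnitRelations X) (M : strictUpper k n) :
    lieHomOfRelations hX M = extMat k X M.1 := rfl

theorem values_lieHomOfRelations {X : Fin n → Fin n → Matrix (Fin d) (Fin d) k}
    (hX : UnitRelations X) : values (lieHomOfRelations hX) = X := by
  funext i j
  rw [values]
  split_ifs with h
  · rw [lieHomOfRelations_apply]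
    change extMat k X (Matrix.single i j 1) = _
    rw [extMat_single, one_smul]
    ext; rfl
  · exact (hX.eq_zero i j (not_lt.mp h)).symm

/-- The coefficients at `t ^ (p ^ l)` of the restrictions of `a` to `t ↦ 1 + t ε_{ij}`. -/
noncomputable def twistedValues (p : ℕ) (a : Matrix (Fin d) (Fin d) (Coord k n)) (l : ℕ)
    (i j : Fin n) : Matrix (Fin d) (Fin d) k :=
  if h : i < j then coeffs a ⟨(i, j), h⟩ (p ^ l) else 0

theorem twistedValues_comm {p : ℕ} [CharP k p] (hp : p.Prime) (hd : 2 * d ≤ p)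
    {a : Matrix (Fin d) (Fin d) (Coord k n)} (ha : IsPointwiseHom a) (l l' : ℕ) {i j i' j' : Fin n}
    (hij : i < j) (hij' : i' < j') :
    twistedValues p a l i j * twistedValues p a l' i' j'
        - twistedValues p a l' i' j' * twistedValues p a l i j
      = if l = l' then (if j = i' then twistedValues p a l i j' else 0)
          - (if j' = i then twistedValues p a l i' j else 0) else 0 := by
  rw [twistedValues, twistedValues, dif_pos hij, dif_pos hij']
  by_cases h1 : j = i'
  · subst h1
    rw [ha.bracket_coeffs hp hd hij hij', add_sub_cancel_left, if_pos rfl,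
      if_neg (hij.trans hij').ne', sub_zero, twistedValues, dif_pos]
  by_cases h2 : j' = i
  · subst h2
    rw [ha.bracket_coeffs hp hd hij' hij, if_neg h1, if_pos rfl, twistedValues,
      dif_pos (hij'.trans hij)]
    by_cases hl : l = l'
    · subst hl; simp
    · rw [if_neg hl, if_neg (Ne.symm hl)]; simp
  · rw [(ha.commute_coeffs (q := ⟨(i, j), hij⟩) (r := ⟨(i', j'), hij'⟩) h1 h2 _ _).eq, sub_self,
      if_neg h1, if_neg h2, sub_zero, ite_self]

theorem exists_eq_bigPhi {p : ℕ} [CharP k p] (hp : p.Prime) (hn : n ≤ p) (hd : 2 * d ≤ p)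
    {a : Matrix (Fin d) (Fin d) (Coord k n)} (ha : IsPointwiseHom a) :
    ∃ (m : ℕ) (φ : Fin (m + 1) → (strictUpper k n →ₗ⁅k⁆ Matrix (Fin d) (Fin d) k)),
      IsCommutingNilpotent φ ∧ a = bigPhi p m φ := by
  have hzero : ∀ l i j, j ≤ i → twistedValues p a l i j = 0 := fun l i j hij =>
    dif_neg (not_lt.mpr hij)
  have hrel : ∀ l, UnitRelations (twistedValues p a l) := fun l =>
    ⟨hzero l, fun i j hij i' j' hij' => by
      rw [twistedValues_comm hp hd ha l l hij hij', if_pos rfl]⟩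
  have hnil : ∀ l i j, IsNilpotent (twistedValues p a l i j) := by
    intro l i j
    rw [twistedValues]
    split_ifs
    · exact (ha.isOneParam _).isNilpotent hp l
    · exact IsNilpotent.zero
  have hcomm : ∀ l l', l ≠ l' → ∀ i j i' j',
      Commute (twistedValues p a l i j) (twistedValues p a l' i' j') := by
    intro l l' hl i j i' j'
    by_cases hij : i < j
    swap
    · rw [hzero l i j (not_lt.mp hij)]; exact Commute.zero_left _
    by_cases hij' : i' < j'
    swap
    · rw [hzero l' i' j' (not_lt.mp hij')]; exact Commute.zero_right _
    have h := twistedValues_comm hp hd ha l l' hij hij'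
    rw [if_neg hl] at h
    exact sub_eq_zero.mp h
  -- The degree bound serves as the number of twists: for `i > m` one has `p ^ i > i > m`, so the
  -- coefficient at `t ^ (p ^ i)` vanishes.
  obtain ⟨m, hm⟩ := exists_degree_bound a
  let φ : Fin (m + 1) → (strictUpper k n →ₗ⁅k⁆ Matrix (Fin d) (Fin d) k) :=
    fun l => lieHomOfRelations (hrel l)
  have hφ : IsCommutingNilpotent φ :=
    ⟨fun l Y => ⟨d, extMat_pow_eq_zero (hrel l) (hnil l) _⟩, fun l l' hl Y Z =>
      commute_extMat (hcomm l l' fun h => hl (Fin.ext h)) _ _⟩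
  refine ⟨m, φ, hφ, ?_⟩
  rcases Nat.eq_zero_or_pos d with rfl | hd0
  · exact Subsingleton.elim _ _
  have hb := isPointwiseHom_bigPhi hp hn hd hφ
  refine ha.ext hb fun q r => (ha.isOneParam q).ext_of_pow hp (hb.isOneParam q) (fun i => ?_) r
  have hres : restrict (bigPhi p m φ) q = (List.ofFn fun l : Fin (m + 1) =>
      expFactor (p ^ (l : ℕ)) (twistedValues p a l q.1.1 q.1.2)).prod := by
    rw [restrict, bigPhi_map_evalAt hp φ (IsUnip.elementary q _)]
    congr 2
    funext l
    obtain ⟨F, hF⟩ := exists_ringHom_pow (k := k) hp k[X] (l : ℕ)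
    -- The factor `1` is inserted so that `groupExp_elementary` applies with `U = 1`.
    have h1 : (1 + Matrix.single q.1.1 q.1.2 (X : k[X])).map (· ^ p ^ (l : ℕ))
        = 1 * (1 + Matrix.single q.1.1 q.1.2 ((X : k[X]) ^ p ^ (l : ℕ))) := by
      rw [one_mul, ← funext hF, Matrix.map_add _ (map_add F),
        Matrix.map_one _ (map_zero F) (map_one F), Matrix.map_single _ _ _ F, hF]
    rw [h1, groupExp_elementary hp hn hd (unitRelations_values _)
      (by rw [values_lieHomOfRelations]; exact hnil l) IsUnip.one, groupExp_one, one_mul,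
      values_lieHomOfRelations]
    rfl
  rw [coeffs, coeffs, hres, (prod_expFactor_coeff hp (by omega) hd0
    (fun l => twistedValues p a l q.1.1 q.1.2) (fun l => hnil l _ _) (m + 1)).2.2 i]
  split_ifs with hi
  · rw [twistedValues, dif_pos q.2]
    rfl
  · refine (hm q).coeff_eq_zero ?_
    have := Nat.lt_pow_self (n := i) hp.one_lt
    omega

end Classification

end UnipotentRep

open UnipotentRep in
theorem theorem1p3 {k : Type*} [Field k] (p n d : ℕ) [CharP k p] (hp : 0 < p)
    (hpnd : max n (2 * d) ≤ p) {V : Type*} [AddCommGroup V] [Module k V]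
    (e : Module.Basis (Fin d) k V) :
    (∀ (m : ℕ) (φ : Fin (m + 1) → (strictUpper k n →ₗ⁅k⁆ Matrix (Fin d) (Fin d) k)),
      IsCommutingNilpotent φ → IsRepresentation (ofMatrix e (bigPhi p m φ))) ∧
    (∀ ρ : V →ₗ[k] V ⊗[k] Coord k n, IsRepresentation ρ →
      ∃ (m : ℕ) (φ : Fin (m + 1) → (strictUpper k n →ₗ⁅k⁆ Matrix (Fin d) (Fin d) k)),
        IsCommutingNilpotent φ ∧ ρ = ofMatrix e (bigPhi p m φ)) := by
  have hprime : p.Prime := (CharP.char_is_prime_or_zero k p).resolve_right hp.ne'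
  obtain ⟨hn, hd⟩ := max_le_iff.mp hpnd
  refine ⟨fun m φ hφ => (isRepresentation_ofMatrix_iff e _).mpr
    (isPointwiseHom_bigPhi hprime hn hd hφ), fun ρ hρ => ?_⟩
  obtain ⟨a, rfl⟩ := exists_eq_ofMatrix e ρ
  obtain ⟨m, φ, hφ, rfl⟩ := exists_eq_bigPhi hprime hn hd ((isRepresentation_ofMatrix_iff e a).mp hρ)
  exact ⟨m, φ, hφ, rfl⟩
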